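/- Let $L=\{1,\cdot,{}^{-1}\}$ be the language of groups and let $0'$ be the halting set. A group $M$ is \emph{existentially closed} if, for every quantifier-free $L$-formula $\theta(\bar x,\bar y)$ and every tuple $\bar a$ from $M$, whenever $\exists\bar x\,\theta(\bar x,\bar a)$ holds in some group containing $M$ as a subgroup, it already holds in $M$. For $A\subseteq\mathbb N$, a countable group $M$ is \emph{$A$-computable} if, for some enumeration $(m_i)_{i<\omega}$ of $M$ (repetitions allowed), the quantifier-free diagram of $M$ with respect to it, i.e. the set of (Gödel numbers of) quantifier-free sentences of $L$ with constants naming the $m_i$ that are true in $M$, is Turing reducible to $A$. A complete quantifier-free type $\Phi(\bar y)$ over the theory of groups is \emph{$\exists_1$-isolated} if there is a formula $\varphi(\bar y)=\exists\bar x\,\theta(\bar x,\bar y)$ with $\theta$ quantifier-free such that $\Phi$ is the unique complete quantifier-free type consistent with $\varphi$ over the theory of groups. Groups $M$ and $N$ are \emph{relatively atomic} if every complete quantifier-free type (in finitely many variables) realised in both $M$ and $N$ is $\exists_1$-isolated. \textbf{Theorem.} Let $A\subseteq\mathbb N$ be computably enumerable relative to $0'$ with $0'\le_{\mathrm T}A$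 and $A\not\le_{\mathrm T}0'$. (1) For every $0'$-computable existentially closed group $N$ there is an $A$-computable existentially closed group $M$ such that $M$ and $N$ are relatively atomic. (2) There are $A$-computable existentially closed groups $M$ and $N$ which are relatively atomic. -/

import Mathlib

namespace ECGroups

/-! ### Turing reducibility, relative computable enumerability, and the halting set -/

/-- The characteristic function of a set of natural numbers, as an oracle. -/
noncomputable def charFun (A : Set ℕ) : ℕ →. ℕ :=
  open Classical in fun n => Part.some (if n ∈ A then 1 else 0)

/-- `A ≤_T B` for sets of natural numbers. -/
def TuringLE (A B : Set ℕ) : Prop :=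
  TuringReducible (charFun A) (charFun B)

/-- `A` is `B`-c.e.: it is the domain of a partial function that is recursive in `B`. -/
def CEIn (B A : Set ℕ) : Prop :=
  ∃ f : ℕ →. ℕ, TuringReducible f (charFun B) ∧ ∀ n, n ∈ A ↔ (f n).Dom

/-- `0′`, the halting set `{e | Φ_e(e)↓}`. -/
def zeroJump : Set ℕ :=
  {e | ((Denumerable.ofNat Nat.Partrec.Code e).eval e).Dom}

/-! ### The first-order language of groups -/

/-- The function symbols of the language `{1, ·, ⁻¹}`. -/
inductive GroupFunc : ℕ → Type
  | one : GroupFunc 0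
  | inv : GroupFunc 1
  | mul : GroupFunc 2

/-- The language `{1, ·, ⁻¹}` of group theory, without relation symbols. -/
abbrev LGroup : FirstOrder.Language.{0, 0} where
  Functions := GroupFunc
  Relations := fun _ => Empty

/-- Every group is a structure in the language of groups. -/
instance groupStructure (G : Type*) [Group G] : LGroup.Structure G where
  funMap
    | GroupFunc.one => fun _ => 1
    | GroupFunc.inv => fun x => (x 0)⁻¹
    | GroupFunc.mul => fun x => x 0 * x 1
  RelMap := fun r => r.elim

/-! ### Existentially closed groups -/

/-- `M` is existentially closed: for each quantifier-free `θ(ȳ, x̄)` and each tuple `a` of parameters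
from `M`, if `∃ x̄, θ(a, x̄)` holds in some group extending `M`, then it holds in `M`. -/
def IsExistentiallyClosed.{u} (M : Type u) [Group M] : Prop :=
  ∀ (k m : ℕ) (θ : LGroup.BoundedFormula (Fin k) m), θ.IsQF → ∀ a : Fin k → M,
    (∃ (H : Type u) (_ : Group H) (f : M →* H), Function.Injective f ∧
      θ.exs.Realize (fun i => f (a i))) →
    θ.exs.Realize a

/-! ### Quantifier-free types and relative atomicity -/

/-- The complete quantifier-free type `qftp^G(a)` of a tuple `a` in a group `G`. -/
def qfType {G : Type*} [Group G] {k : ℕ} (a : Fin k → G) : Set (LGroup.Formula (Fin k)) :=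
  {φ | φ.IsQF ∧ φ.Realize a}

/-- `Φ` is a complete quantifier-free type (over the theory of groups) in `k` variables. -/
def IsCompleteQFType {k : ℕ} (Φ : Set (LGroup.Formula (Fin k))) : Prop :=
  ∃ (G : Type) (_ : Group G) (a : Fin k → G), qfType a = Φ

/-- `Φ` is consistent with the formula `φ` over the theory of groups. -/
def ConsistentWith {k : ℕ} (φ : LGroup.Formula (Fin k)) (Φ : Set (LGroup.Formula (Fin k))) : Prop :=
  ∃ (G : Type) (_ : Group G) (a : Fin k → G), φ.Realize a ∧ ∀ ψ ∈ Φ, ψ.Realize a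

/-- `Φ` is `∃₁`-isolated: for some `∃₁`-formula `∃ x̄, θ(ȳ, x̄)`, it is the unique complete
quantifier-free type that is consistent with this formula over the theory of groups. -/
def IsExistsIsolated {k : ℕ} (Φ : Set (LGroup.Formula (Fin k))) : Prop :=
  ∃ (m : ℕ) (θ : LGroup.BoundedFormula (Fin k) m), θ.IsQF ∧
    (IsCompleteQFType Φ ∧ ConsistentWith θ.exs Φ) ∧
    ∀ Ψ, IsCompleteQFType Ψ → ConsistentWith θ.exs Ψ → Ψ = Φ

/-- `M` and `N` are relatively atomic: every (complete) quantifier-free type that is realised in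
both of them is `∃₁`-isolated. -/
def RelativelyAtomic (M N : Type*) [Group M] [Group N] : Prop :=
  ∀ (k : ℕ) (Φ : Set (LGroup.Formula (Fin k))),
    (∃ c : Fin k → M, qfType c = Φ) → (∃ d : Fin k → N, qfType d = Φ) → IsExistsIsolated Φ

/-! ### Gödel numbers and the quantifier-free diagram -/

/-- The Gödel number of a term. -/
def termCode {n : ℕ} : LGroup.Term (ℕ ⊕ Fin n) → ℕ
  | .var (.inl i) => Nat.pair 0 i
  | .var (.inr j) => Nat.pair 1 j
  | .func GroupFunc.one _ => Nat.pair 2 0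
  | .func GroupFunc.inv t => Nat.pair 3 (termCode (t 0))
  | .func GroupFunc.mul t => Nat.pair 4 (Nat.pair (termCode (t 0)) (termCode (t 1)))

/-- The Gödel number of a formula. -/
def formulaCode : {n : ℕ} → LGroup.BoundedFormula ℕ n → ℕ
  | _, .falsum => Nat.pair 0 0
  | _, .equal s t => Nat.pair 1 (Nat.pair (termCode s) (termCode t))
  | _, .rel r _ => Empty.elim r
  | _, .imp φ ψ => Nat.pair 2 (Nat.pair (formulaCode φ) (formulaCode ψ))
  | _, .all φ => Nat.pair 3 (formulaCode φ)

/-- The set of Gödel numbers of the quantifier-free diagram of `M` with respect to the enumeration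
`(e i)_{i < ω}` of `M`; the variable with index `i` is the constant symbol naming `e i`. -/
def qfDiagram {M : Type*} [Group M] (e : ℕ → M) : Set ℕ :=
  formulaCode '' {φ : LGroup.Formula ℕ | φ.IsQF ∧ φ.Realize e}

/-- `M` is `A`-computable: `A` computes the quantifier-free diagram of `M` with respect to
some enumeration of `M`. -/
def IsComputableFrom (A : Set ℕ) (M : Type*) [Group M] : Prop :=
  ∃ e : ℕ → M, Function.Surjective e ∧ TuringLE (qfDiagram e) A

end ECGroups

/-! A group marked by generators x₀, x₁, … is coded by the binary sequence telling which words in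
the generators are trivial. The finite initial segments of such sequences form a tree without dead
ends. A word is forced to be trivial by finitely many relations exactly when it is a product of
conjugates of them, so inconsistency is c.e. and `0′` decides the tree (`predIn_isConsistent`). By
compactness every path is the diagram of a marked group (`exists_group_of_path`).

Both properties wanted of `M` amount to meeting dense sets of strings. For existential closedness,
take a finite system of equations and inequations over the generators: the strings that either
declare a solution among the generators or exclude every solution are dense (`denseIn_settles`). A
path meeting all these sets gives an existentially closed group in which every element is a
generator. For relative atomicity, take a tuple of generators and a tuple of `N`, and consider the
strings declaring that the two tuples disagree on some word. If these are not dense, some consistent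
`σ` has no such consistent extension, and the formula "`y` is part of a tuple whose diagram begins
with `σ`" isolates the type (`isExistsIsolated_of_not_denseIn`). So it suffices that the path meets
those of these sets that are dense.

The construction is not told which of these sets are dense. For each dense one, however, `0′`
computes a bound, as a function of `s`, for the search for extensions of strings of length `s`
(`exists_reachBound`). A set `A` that is c.e. in `0′`, above `0′` and not computable from `0′`
computes a monotone `g` that lies above any given `0′`-computable function infinitely often
(`exists_escaping`). Searching only below `g`, a finite-injury priority construction (`exists_path`)
produces an `A`-computable path that meets every dense requirement. This gives (1). For (2), the
existential closedness requirements are all known to be dense, so the bounds can be combined into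
one `0′`-computable function; this yields a `0′`-computable existentially closed group, to which (1)
applies. -/

open Encodable

/-! ### Closure properties of computability relative to oracles. -/

namespace ComputableIn

variable {α β γ σ : Type*} [Primcodable α] [Primcodable β] [Primcodable γ] [Primcodable σ]
variable {O : Set (ℕ →. ℕ)}

theorem of_eq {f g : α → σ} (hf : ComputableIn O f) (H : ∀ a, f a = g a) : ComputableIn O g :=
  (funext H : f = g) ▸ hf

theorem comp {f : β → σ} {g : α → β} (hf : ComputableIn O f) (hg : ComputableIn O g) :
    ComputableIn O fun a => f (g a) :=
  (Nat.RecursiveIn.comp hf hg).of_eq fun n => by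
    simp only [Part.map_some, Part.bind_eq_bind]
    rcases e : decode (α := α) n with - | a <;> simp [encodek]

theorem pair {f : α → β} {g : α → γ} (hf : ComputableIn O f) (hg : ComputableIn O g) :
    ComputableIn O fun a => (f a, g a) :=
  (Nat.RecursiveIn.pair hf hg).of_eq fun n => by
    rcases e : decode (α := α) n with - | a <;> simp [Seq.seq]

theorem comp₂ {f : β → γ → σ} {g : α → β} {h : α → γ} (hf : ComputableIn₂ O f)
    (hg : ComputableIn O g) (hh : ComputableIn O h) : ComputableIn O fun a => f (g a) (h a) :=
  comp hf (pair hg hh)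

theorem primrec_comp {f : β → σ} {g : α → β} (hf : Primrec f) (hg : ComputableIn O g) :
    ComputableIn O fun a => f (g a) :=
  hf.computableIn.comp hg

theorem primrec_comp₂ {f : β → γ → σ} {g : α → β} {h : α → γ} (hf : Primrec₂ f)
    (hg : ComputableIn O g) (hh : ComputableIn O h) : ComputableIn O fun a => f (g a) (h a) :=
  comp₂ hf.computableIn₂ hg hh

theorem nat_rec {f : α → ℕ} {g : α → σ} {h : α → ℕ × σ → σ} (hf : ComputableIn O f)
    (hg : ComputableIn O g) (hh : ComputableIn₂ O h) :
    ComputableIn O fun a => Nat.rec (motive := fun _ => σ) (g a) (fun y IH => h a (y, IH)) (f a) :=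
  ((Nat.RecursiveIn.prec hg hh).comp
      (Nat.RecursiveIn.pair (Nat.Primrec.recursiveIn Nat.Primrec.id) hf)).of_eq fun n => by
    rcases e : decode (α := α) n with - | a
    · simp [Seq.seq]
    · simp only [Part.coe_some, Part.bind_some, Part.map_some, Seq.seq]
      simp only [Part.bind_eq_bind, Part.map_eq_map, Part.map_some, Part.bind_some,
        Nat.unpair_pair]
      induction f a with
      | zero => simp [e]
      | succ m ih =>
        simp [e] at ih ⊢
        simp [ih]

theorem rfind {p : α → ℕ → Bool} (hp : ComputableIn₂ O p) :
    RecursiveIn O fun a => Nat.rfind (p a) := by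
  have h : ComputableIn₂ O fun a n => cond (p a n) 0 1 :=
    comp (Primrec.dom_bool fun b => cond b 0 1).computableIn hp
  refine (Nat.RecursiveIn.rfind h).of_eq fun n => ?_
  rcases e : decode (α := α) n with - | a
  · simpa [e] using Nat.rfind_zero_none (fun _ => Part.none) rfl
  · have h2 : Part.map encode (Nat.rfind fun m => Part.some (p a m)) =
        Nat.rfind fun m => Part.some (p a m) := Part.map_id' (fun _ => rfl) _
    simp only [e, Part.coe_some, Part.bind_some, Part.map_some, Nat.unpair_pair,
      Encodable.decode_prod_val, Option.bind_some, Encodable.decode_nat, Option.map_some]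
    refine Eq.trans ?_ h2.symm
    congr 1
    funext m
    cases p a m <;> simp

theorem nat_casesOn_const {f : α → ℕ} {g h : α → σ} (hf : ComputableIn O f) (hg : ComputableIn O g)
    (hh : ComputableIn O h) : ComputableIn O fun a => if f a = 0 then g a else h a :=
  (nat_rec (h := fun a _ => h a) hf hg (hh.comp ComputableIn.fst)).of_eq fun a => by
    cases f a <;> simp

theorem cond {c : α → Bool} {f g : α → σ} (hc : ComputableIn O c) (hf : ComputableIn O f)
    (hg : ComputableIn O g) : ComputableIn O fun a => cond (c a) (f a) (g a) :=
  (nat_casesOn_const (f := fun a => Bool.toNat (c a))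
    (primrec_comp (Primrec.dom_bool _) hc) hg hf).of_eq fun a => by
    cases c a <;> simp

theorem list_map [Inhabited β] {f : α → List β} {g : β → σ} (hf : ComputableIn O f)
    (hg : ComputableIn O g) : ComputableIn O fun a => (f a).map g := by
  have h := nat_rec (f := fun a => (f a).length) (g := fun _ => ([] : List σ))
    (h := fun a p => p.2 ++ [g ((f a).getI p.1)])
    (primrec_comp Primrec.list_length hf) (ComputableIn.const _)
    (primrec_comp₂ (f := fun l x => l ++ [x]) Primrec.list_concat (ComputableIn.snd.comp ComputableIn.snd)
      (hg.comp (primrec_comp₂ Primrec.list_getI (hf.comp ComputableIn.fst)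
        (ComputableIn.fst.comp ComputableIn.snd))))
  refine h.of_eq fun a => ?_
  have key : ∀ n ≤ (f a).length, Nat.rec (motive := fun _ => List σ) []
      (fun y IH => IH ++ [g ((f a).getI y)]) n = ((f a).take n).map g := by
    intro n hn
    induction n with
    | zero => simp
    | succ n ih =>
      simp only
      rw [ih (by omega), ← List.take_concat_get' _ n (by omega),
        List.getI_eq_getElem _ (by omega)]
      simp only [List.map_append, List.map_cons, List.map_nil]
  simpa using key _ le_rfl

theorem sum_range {h : α → ℕ → ℕ} {f : α → ℕ} (hh : ComputableIn₂ O h) (hf : ComputableIn O f) :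
    ComputableIn O fun a => ∑ i ∈ Finset.range (f a), h a i :=
  (nat_rec (h := fun a p => p.2 + h a p.1) hf (ComputableIn.const 0)
    (primrec_comp₂ Primrec.nat_add (ComputableIn.snd.comp ComputableIn.snd)
      (comp₂ hh ComputableIn.fst (ComputableIn.fst.comp ComputableIn.snd)))).of_eq fun a => by
    induction f a with
    | zero => simp
    | succ n ih => simp only [ih, Finset.sum_range_succ]

theorem nat_strong_rec (f : ℕ → σ) {g : List σ → σ} (hg : ComputableIn O g)
    (H : ∀ n, g ((List.range n).map f) = f n) : ComputableIn O f := by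
  have h := nat_rec (f := fun n : ℕ => n) (g := fun _ => ([] : List σ))
    (h := fun _ p => p.2 ++ [g p.2]) (O := O) ComputableIn.id (ComputableIn.const _)
    (primrec_comp₂ (f := fun l x => l ++ [x]) Primrec.list_concat (ComputableIn.snd.comp ComputableIn.snd)
      (hg.comp (ComputableIn.snd.comp ComputableIn.snd)))
  refine (hg.comp h).of_eq fun n => ?_
  rw [← H n]
  congr 1
  induction n with
  | zero => simp
  | succ n ih => simp only [ih, List.range_succ, List.map_append, List.map_cons, List.map_nil, H]

theorem map_range {f : ℕ → σ} (hf : ComputableIn O f) :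
    ComputableIn O fun n => (List.range n).map f :=
  list_map (Primrec.list_range.computableIn) hf

end ComputableIn

/-! ### Predicates decidable relative to oracles, and searches. -/

/-- The predicate `p` is decidable relative to the oracles in `O`. -/
def PredIn {α : Type*} [Primcodable α] (O : Set (ℕ →. ℕ)) (p : α → Prop) : Prop :=
  ∃ f : α → Bool, ComputableIn O f ∧ ∀ a, f a = true ↔ p a

namespace PredIn

variable {α β γ σ : Type*} [Primcodable α] [Primcodable β] [Primcodable γ] [Primcodable σ]
variable {O : Set (ℕ →. ℕ)}

theorem of_iff {p q : α → Prop} (hp : PredIn O p) (H : ∀ a, p a ↔ q a) : PredIn O q :=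
  (funext fun a => propext (H a) : p = q) ▸ hp

theorem of_primrec {p : α → Prop} (hp : PrimrecPred p) : PredIn O p := by
  classical
  exact ⟨_, hp.decide.computableIn, fun a => by simp⟩

theorem computableIn {p : α → Prop} [DecidablePred p] (hp : PredIn O p) :
    ComputableIn O fun a => decide (p a) := by
  obtain ⟨f, hf, h⟩ := hp
  exact hf.of_eq fun a => by rw [Bool.eq_iff_iff]; simp [h]

theorem comp {p : β → Prop} {f : α → β} (hp : PredIn O p) (hf : ComputableIn O f) :
    PredIn O fun a => p (f a) := by
  obtain ⟨g, hg, h⟩ := hp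
  exact ⟨_, hg.comp hf, fun a => h _⟩

theorem not {p : α → Prop} (hp : PredIn O p) : PredIn O fun a => ¬ p a := by
  obtain ⟨g, hg, h⟩ := hp
  exact ⟨_, ComputableIn.primrec_comp Primrec.not hg, fun a => by simp [← h]⟩

theorem and {p q : α → Prop} (hp : PredIn O p) (hq : PredIn O q) :
    PredIn O fun a => p a ∧ q a := by
  obtain ⟨g, hg, h⟩ := hp
  obtain ⟨g', hg', h'⟩ := hq
  exact ⟨_, ComputableIn.primrec_comp₂ Primrec.and hg hg', fun a => by simp [← h, ← h']⟩

theorem or {p q : α → Prop} (hp : PredIn O p) (hq : PredIn O q) :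
    PredIn O fun a => p a ∨ q a := by
  obtain ⟨g, hg, h⟩ := hp
  obtain ⟨g', hg', h'⟩ := hq
  exact ⟨_, ComputableIn.primrec_comp₂ Primrec.or hg hg', fun a => by simp [← h, ← h']⟩

theorem ite {p : α → Prop} [DecidablePred p] {f g : α → σ} (hp : PredIn O p)
    (hf : ComputableIn O f) (hg : ComputableIn O g) :
    ComputableIn O fun a => if p a then f a else g a :=
  (ComputableIn.cond hp.computableIn hf hg).of_eq fun a => by by_cases h : p a <;> simp [h]

theorem of_eq_true {f : α → Bool} (hf : ComputableIn O f) : PredIn O fun a => f a = true :=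
  ⟨f, hf, fun _ => Iff.rfl⟩

/-- Minimality of the value found is part of the conclusion because the priority construction relies
on choosing least targets and least requirements. -/
theorem exists_find {p : α → ℕ → Prop} (hp : PredIn O fun x : α × ℕ => p x.1 x.2)
    (H : ∀ a, ∃ n, p a n) :
    ∃ f : α → ℕ, ComputableIn O f ∧ ∀ a, p a (f a) ∧ ∀ m < f a, ¬ p a m := by
  classical
  obtain ⟨g, hg, h⟩ := hp
  have hg' : ComputableIn₂ O fun a n => g (a, n) := hg
  refine ⟨fun a => Nat.find (H a), ?_, fun a => ⟨Nat.find_spec (H a), fun m => Nat.find_min _⟩⟩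
  refine (ComputableIn.rfind hg').of_eq_tot fun a => ?_
  rw [Nat.mem_rfind]
  constructor
  · have := (h (a, _)).2 (Nat.find_spec (H a))
    exact Part.mem_some_iff.2 this.symm
  · intro m hm
    have := mt (h (a, m)).1 (Nat.find_min (H a) hm)
    exact Part.mem_some_iff.2 (Bool.eq_false_iff.2 this).symm

/-- The unbounded search for `n` with `p a n` or `f a ≤ n` always stops, and it stops below `f a`
exactly when there is a witness there. -/
theorem exists_lt {p : α → ℕ → Prop} {f : α → ℕ} (hp : PredIn O fun x : α × ℕ => p x.1 x.2)
    (hf : ComputableIn O f) : PredIn O fun a => ∃ n < f a, p a n := by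
  have h : PredIn O fun x : α × ℕ => p x.1 x.2 ∨ f x.1 ≤ x.2 :=
    hp.or ((of_primrec Primrec.nat_le).comp
      ((hf.comp ComputableIn.fst).pair ComputableIn.snd))
  obtain ⟨g, hg, hg'⟩ := exists_find (p := fun a n => p a n ∨ f a ≤ n) h fun a => ⟨f a, Or.inr le_rfl⟩
  refine ((of_primrec Primrec.nat_lt).comp (hg.pair hf)).of_iff fun a => ?_
  obtain ⟨h1, h2⟩ := hg' a
  constructor
  · intro h
    exact ⟨_, h, h1.resolve_right (by simpa using h)⟩
  · rintro ⟨n, hn, hpn⟩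
    by_contra hlt
    exact h2 n (lt_of_lt_of_le hn (not_lt.1 hlt)) (Or.inl hpn)

end PredIn

/-! ### Oracle sets and the halting set. -/

namespace ECGroups

/-- The oracle set consisting of the characteristic function of `A`. -/
noncomputable abbrev oracleOf (A : Set ℕ) : Set (ℕ →. ℕ) := {charFun A}

theorem turingLE_iff_predIn {A B : Set ℕ} : TuringLE A B ↔ PredIn (oracleOf B) (· ∈ A) := by
  classical
  constructor
  · intro h
    have h' : ComputableIn (oracleOf B) fun n => if n ∈ A then 1 else 0 :=
      RecursiveIn.of_eq h fun n => by simp [charFun]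
    exact ((PredIn.of_primrec (Primrec.eq (α := ℕ))).comp
      (h'.pair (ComputableIn.const 1))).of_iff fun a => by simp
  · intro h
    have h' : ComputableIn (oracleOf B) fun n => if n ∈ A then 1 else 0 :=
      h.ite (ComputableIn.const 1) (ComputableIn.const 0)
    exact RecursiveIn.of_eq h' fun n => by simp [charFun]

theorem computableIn_of_turingLE {α σ : Type*} [Primcodable α] [Primcodable σ] {A B : Set ℕ}
    (h : TuringLE A B) {f : α → σ} (hf : ComputableIn (oracleOf A) f) :
    ComputableIn (oracleOf B) f :=
  RecursiveIn.subst hf fun g hg => by rw [Set.mem_singleton_iff.1 hg]; exact h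

theorem predIn_of_turingLE {α : Type*} [Primcodable α] {A B : Set ℕ}
    (h : TuringLE A B) {p : α → Prop} (hp : PredIn (oracleOf A) p) : PredIn (oracleOf B) p := by
  obtain ⟨f, hf, hfp⟩ := hp
  exact ⟨f, computableIn_of_turingLE h hf, hfp⟩

/-- The halting set decides every recursively enumerable predicate. -/
theorem predIn_zeroJump_of_rePred {α : Type*} [Primcodable α] {p : α → Prop} (hp : REPred p) :
    PredIn (oracleOf zeroJump) p := by
  obtain ⟨c, hc⟩ := Nat.Partrec.Code.exists_code.1 hp
  have hz : PredIn (oracleOf zeroJump) (· ∈ zeroJump) :=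
    turingLE_iff_predIn.1 (TuringReducible.refl _)
  -- This program ignores its input and runs `c` on `a`, so it halts on its own code exactly when `p
  -- a` holds.
  have hcode : Primrec fun a : α => encode (c.comp (Nat.Partrec.Code.const (encode a))) :=
    Primrec.encode.comp (Nat.Partrec.Code.primrec₂_comp.comp (Primrec.const c)
      (Nat.Partrec.Code.primrec_const.comp Primrec.encode))
  refine (hz.comp hcode.computableIn).of_iff fun a => ?_
  simp only [zeroJump, Set.mem_ofPred_eq, Denumerable.ofNat_encode, Nat.Partrec.Code.eval,
    Nat.Partrec.Code.eval_const, hc]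
  simp [encodek, Part.assert]

/-! ### Oracle computations from finite initial segments of the oracle. -/

/-- The first `s` values of a total function. -/
def initSeg (o : ℕ → ℕ) (s : ℕ) : List ℕ := (List.range s).map o

theorem initSeg_prefix (o : ℕ → ℕ) {s t : ℕ} (h : s ≤ t) :
    ∃ l, initSeg o t = initSeg o s ++ l := by
  obtain ⟨d, rfl⟩ := Nat.exists_eq_add_of_le h
  exact ⟨_, by rw [initSeg, List.range_add, List.map_append, initSeg]⟩

/-- `F` computes `f` from longer and longer initial segments of the oracle `o`. -/
structure IsStageFunction (o : ℕ → ℕ) (f : ℕ →. ℕ) (F : ℕ → List ℕ → Option ℕ) : Prop where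
  primrec : Primrec₂ F
  mono : ∀ n l l' m, F n l = some m → F n (l ++ l') = some m
  mem_iff : ∀ n m, m ∈ f n ↔ ∃ s, F n (initSeg o s) = some m

namespace IsStageFunction

variable {o : ℕ → ℕ} {f : ℕ →. ℕ} {F : ℕ → List ℕ → Option ℕ}

theorem mono_initSeg (h : IsStageFunction o f F) {n s t m : ℕ} (hst : s ≤ t)
    (hs : F n (initSeg o s) = some m) : F n (initSeg o t) = some m := by
  obtain ⟨l, hl⟩ := initSeg_prefix o hst
  rw [hl]
  exact h.mono _ _ _ _ hs

theorem of_total {g : ℕ → ℕ} (hg : Primrec g) :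
    IsStageFunction o (fun n => Part.some (g n)) (fun n _ => some (g n)) where
  primrec := Primrec.option_some.comp (hg.comp Primrec.fst)
  mono := by simp
  mem_iff := by simp [eq_comm]

theorem oracle : IsStageFunction o (fun n => Part.some (o n)) (fun n l => l[n]?) where
  primrec := Primrec.list_getElem?.comp Primrec.snd Primrec.fst
  mono := by
    intro n l l' m h
    rw [List.getElem?_append_left (List.getElem?_eq_some_iff.1 h).1, h]
  mem_iff := by
    intro n m
    simp only [initSeg, Part.mem_some_iff]
    constructor
    · rintro rfl
      exact ⟨n + 1, by simp⟩
    · rintro ⟨s, hs⟩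
      simp only [List.getElem?_map, Option.map_eq_some_iff] at hs
      obtain ⟨a, ha, rfl⟩ := hs
      obtain ⟨_, rfl⟩ := List.getElem?_eq_some_iff.1 ha
      simp

theorem pair {g : ℕ →. ℕ} {G : ℕ → List ℕ → Option ℕ} (hf : IsStageFunction o f F)
    (hg : IsStageFunction o g G) :
    IsStageFunction o (fun n => Nat.pair <$> f n <*> g n)
      (fun n l => (F n l).bind fun a => (G n l).map fun b => Nat.pair a b) where
  primrec := Primrec.option_bind hf.primrec
    (Primrec.option_map (hg.primrec.comp (Primrec.fst.comp Primrec.fst)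
      (Primrec.snd.comp Primrec.fst))
      (Primrec₂.natPair.comp (Primrec.snd.comp Primrec.fst) Primrec.snd))
  mono := by
    intro n l l' m h
    simp only [Option.bind_eq_some_iff, Option.map_eq_some_iff] at h ⊢
    obtain ⟨a, ha, b, hb, rfl⟩ := h
    exact ⟨a, hf.mono _ _ _ _ ha, b, hg.mono _ _ _ _ hb, rfl⟩
  mem_iff := by
    intro n m
    simp only [Seq.seq, Part.map_eq_map, Part.mem_bind_iff, Part.mem_map_iff,
      Option.bind_eq_some_iff, Option.map_eq_some_iff]
    constructor
    · rintro ⟨_, ⟨a, ha, rfl⟩, b, hb, rfl⟩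
      obtain ⟨s, hs⟩ := (hf.mem_iff _ _).1 ha
      obtain ⟨t, ht⟩ := (hg.mem_iff _ _).1 hb
      exact ⟨max s t, a, hf.mono_initSeg (le_max_left _ _) hs, b,
        hg.mono_initSeg (le_max_right _ _) ht, rfl⟩
    · rintro ⟨s, a, ha, b, hb, rfl⟩
      exact ⟨_, ⟨a, (hf.mem_iff _ _).2 ⟨s, ha⟩, rfl⟩, b, (hg.mem_iff _ _).2 ⟨s, hb⟩, rfl⟩

theorem comp {g : ℕ →. ℕ} {G : ℕ → List ℕ → Option ℕ} (hf : IsStageFunction o f F)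
    (hg : IsStageFunction o g G) :
    IsStageFunction o (fun n => g n >>= f) (fun n l => (G n l).bind fun a => F a l) where
  primrec := Primrec.option_bind hg.primrec
    (hf.primrec.comp Primrec.snd (Primrec.snd.comp Primrec.fst))
  mono := by
    intro n l l' m h
    simp only [Option.bind_eq_some_iff] at h ⊢
    obtain ⟨a, ha, hb⟩ := h
    exact ⟨a, hg.mono _ _ _ _ ha, hf.mono _ _ _ _ hb⟩
  mem_iff := by
    intro n m
    refine Part.mem_bind_iff.trans ?_
    simp only [Option.bind_eq_some_iff]
    constructor
    · rintro ⟨a, ha, hb⟩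
      obtain ⟨s, hs⟩ := (hg.mem_iff _ _).1 ha
      obtain ⟨t, ht⟩ := (hf.mem_iff _ _).1 hb
      exact ⟨max s t, a, hg.mono_initSeg (le_max_left _ _) hs,
        hf.mono_initSeg (le_max_right _ _) ht⟩
    · rintro ⟨s, a, ha, hb⟩
      exact ⟨a, (hg.mem_iff _ _).2 ⟨s, ha⟩, (hf.mem_iff _ _).2 ⟨s, hb⟩⟩

theorem prec {g : ℕ →. ℕ} {G : ℕ → List ℕ → Option ℕ} (hf : IsStageFunction o f F)
    (hg : IsStageFunction o g G) :
    IsStageFunction o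
      (fun p => Nat.rec (motive := fun _ => Part ℕ) (f p.unpair.1)
        (fun y IH => IH >>= fun i => g (Nat.pair p.unpair.1 (Nat.pair y i))) p.unpair.2)
      (fun p l => Nat.rec (motive := fun _ => Option ℕ) (F p.unpair.1 l)
        (fun y IH => IH.bind fun i => G (Nat.pair p.unpair.1 (Nat.pair y i)) l) p.unpair.2) where
  primrec := by
    refine Primrec.nat_rec' (f := fun x : ℕ × List ℕ => x.1.unpair.2)
      (g := fun x : ℕ × List ℕ => F x.1.unpair.1 x.2)
      (h := fun x : ℕ × List ℕ => fun q : ℕ × Option ℕ =>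
        q.2.bind fun i => G (Nat.pair x.1.unpair.1 (Nat.pair q.1 i)) x.2)
      (Primrec.snd.comp (Primrec.unpair.comp Primrec.fst))
      (hf.primrec.comp (Primrec.fst.comp (Primrec.unpair.comp Primrec.fst)) Primrec.snd) ?_
    refine Primrec.option_bind (Primrec.snd.comp Primrec.snd) ?_
    refine hg.primrec.comp (Primrec₂.natPair.comp (Primrec.fst.comp (Primrec.unpair.comp
      (Primrec.fst.comp (Primrec.fst.comp Primrec.fst)))) (Primrec₂.natPair.comp
        (Primrec.fst.comp (Primrec.snd.comp Primrec.fst)) Primrec.snd))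
        (Primrec.snd.comp (Primrec.fst.comp Primrec.fst))
  mono := by
    intro p l l' m h
    revert m
    induction p.unpair.2 with
    | zero => exact fun m h => hf.mono _ _ _ _ h
    | succ y ih =>
      intro m h
      simp only [Option.bind_eq_some_iff] at h ⊢
      obtain ⟨i, hi, hm⟩ := h
      exact ⟨i, ih _ hi, hg.mono _ _ _ _ hm⟩
  mem_iff := by
    intro p m
    have hmono : ∀ y s t m, s ≤ t → Nat.rec (motive := fun _ => Option ℕ)
        (F p.unpair.1 (initSeg o s))
        (fun y IH => IH.bind fun i => G (Nat.pair p.unpair.1 (Nat.pair y i)) (initSeg o s)) y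
          = some m → Nat.rec (motive := fun _ => Option ℕ) (F p.unpair.1 (initSeg o t))
        (fun y IH => IH.bind fun i => G (Nat.pair p.unpair.1 (Nat.pair y i)) (initSeg o t)) y
          = some m := by
      intro y s t m hst
      induction y generalizing m with
      | zero => exact fun h => hf.mono_initSeg hst h
      | succ y ih =>
        intro h
        simp only [Option.bind_eq_some_iff] at h ⊢
        obtain ⟨i, hi, hm⟩ := h
        exact ⟨i, ih _ hi, hg.mono_initSeg hst hm⟩
    revert m
    induction p.unpair.2 with
    | zero => exact fun m => hf.mem_iff _ _
    | succ y ih =>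
      intro m
      simp only [Part.bind_eq_bind, Part.mem_bind_iff, Option.bind_eq_some_iff] at ih ⊢
      constructor
      · rintro ⟨i, hi, hm⟩
        obtain ⟨s, hs⟩ := (ih _).1 hi
        obtain ⟨t, ht⟩ := (hg.mem_iff _ _).1 hm
        exact ⟨max s t, i, hmono _ _ _ _ (le_max_left _ _) hs,
          hg.mono_initSeg (le_max_right _ _) ht⟩
      · rintro ⟨s, i, hi, hm⟩
        exact ⟨i, (ih _).2 ⟨s, hi⟩, (hg.mem_iff _ _).2 ⟨s, hm⟩⟩

/-- Unbounded search at a finite stage: the least `k ≤ l.length` at which the value `0` is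
available, provided that all earlier values are available and positive. -/
def search (F : ℕ → List ℕ → Option ℕ) (a : ℕ) (l : List ℕ) : Option ℕ :=
  let k := (List.range l.length).findIdx fun k => ((F (Nat.pair a k) l).getD 0 == 0)
  if F (Nat.pair a k) l = some 0 then some k else none

/-- The default value `0` makes the index search halt at the first unavailable value as well; the
final test in `search` then rejects that case. It also handles the case where nothing is found and
the index is `l.length`. -/
theorem search_eq_some {a : ℕ} {l : List ℕ} {k : ℕ} :
    search F a l = some k ↔ k ≤ l.length ∧ F (Nat.pair a k) l = some 0 ∧
      ∀ j < k, ∃ m, F (Nat.pair a j) l = some (m + 1) := by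
  have hpos : ∀ x : Option ℕ, (x.getD 0 == 0) = false ↔ ∃ m, x = some (m + 1) := by
    intro x
    rcases x with _ | _ | m <;> simp
  have hlen := List.findIdx_le_length (xs := List.range l.length)
    (p := fun k => ((F (Nat.pair a k) l).getD 0 == 0))
  have hbefore : ∀ j < (List.range l.length).findIdx
      fun k => ((F (Nat.pair a k) l).getD 0 == 0), ∃ m, F (Nat.pair a j) l = some (m + 1) := by
    intro j hj
    have := List.not_of_lt_findIdx hj
    rw [← hpos]
    simpa using this
  rw [search]
  constructor
  · intro h
    split_ifs at h with h0
    cases h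
    exact ⟨by simpa using hlen, h0, hbefore⟩
  · rintro ⟨h1, h2, h3⟩
    have : (List.range l.length).findIdx (fun k => ((F (Nat.pair a k) l).getD 0 == 0)) = k := by
      apply le_antisymm
      · by_contra! hlt
        obtain ⟨m, hm⟩ := hbefore k hlt
        rw [h2] at hm
        simp at hm
      · by_contra! hlt
        obtain ⟨m, hm⟩ := h3 _ hlt
        have := List.findIdx_getElem (xs := List.range l.length)
          (p := fun k => ((F (Nat.pair a k) l).getD 0 == 0))
          (w := by simpa using lt_of_lt_of_le hlt h1)
        simp [hm] at this
    rw [this, if_pos h2]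

theorem rfind (hf : IsStageFunction o f F) :
    IsStageFunction o (fun a => Nat.rfind fun n => (fun m => decide (m = 0)) <$> f (Nat.pair a n))
      (search F) where
  primrec := by
    have hF : Primrec₂ fun (x : ℕ × List ℕ) (k : ℕ) => F (Nat.pair x.1 k) x.2 :=
      hf.primrec.comp (Primrec₂.natPair.comp (Primrec.fst.comp Primrec.fst) Primrec.snd)
        (Primrec.snd.comp Primrec.fst)
    have hk : Primrec fun x : ℕ × List ℕ => (List.range x.2.length).findIdx fun k =>
        ((F (Nat.pair x.1 k) x.2).getD 0 == 0) :=
      Primrec.list_findIdx (Primrec.list_range.comp (Primrec.list_length.comp Primrec.snd))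
        (Primrec.beq.comp (Primrec.option_getD.comp hF (Primrec.const 0)) (Primrec.const 0))
    exact Primrec.ite (Primrec.eq.comp (hF.comp Primrec.id hk) (Primrec.const (some 0)))
      (Primrec.option_some.comp hk) (Primrec.const none)
  mono := by
    intro n l l' m
    simp only [search_eq_some, List.length_append]
    rintro ⟨h1, h2, h3⟩
    refine ⟨by omega, hf.mono _ _ _ _ h2, fun j hj => ?_⟩
    obtain ⟨m, hm⟩ := h3 j hj
    exact ⟨m, hf.mono _ _ _ _ hm⟩
  mem_iff := by
    intro a k
    have hmem : ∀ (b : Bool) (n : ℕ), b ∈ ((f (Nat.pair a n)).map fun m => decide (m = 0)) ↔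
        ∃ m ∈ f (Nat.pair a n), decide (m = 0) = b := fun b n => Part.mem_map_iff _
    refine Nat.mem_rfind.trans ?_
    simp only [search_eq_some]
    constructor
    · rintro ⟨hk, hlt⟩
      obtain ⟨m, hm, h0⟩ := (hmem _ _).1 hk
      obtain rfl := of_decide_eq_true h0
      obtain ⟨s, hs⟩ := (hf.mem_iff _ _).1 hm
      have hlt' : ∀ j < k, ∃ t m, F (Nat.pair a j) (initSeg o t) = some (m + 1) := by
        intro j hj
        obtain ⟨m, hm, h0⟩ := (hmem _ _).1 (hlt hj)
        obtain ⟨t, ht⟩ := (hf.mem_iff _ _).1 hm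
        obtain ⟨m, rfl⟩ := Nat.exists_eq_succ_of_ne_zero (of_decide_eq_false h0)
        exact ⟨t, m, ht⟩
      choose! t m ht using hlt'
      -- The stage must be at least `k` since `search` looks no further than the length of the list;
      -- the other summands make the value at `k` and all earlier values available.
      refine ⟨k + s + ∑ j ∈ Finset.range k, t j, by simp [initSeg]; omega,
        hf.mono_initSeg (by omega) hs, fun j hj => ⟨m j, hf.mono_initSeg ?_ (ht j hj)⟩⟩
      have := Finset.single_le_sum (f := t) (fun _ _ => Nat.zero_le _) (Finset.mem_range.2 hj)
      omega
    · rintro ⟨s, -, h0, hlt⟩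
      refine ⟨(hmem _ _).2 ⟨0, (hf.mem_iff _ _).2 ⟨s, h0⟩, rfl⟩, fun {j} hj => ?_⟩
      obtain ⟨m, hm⟩ := hlt j hj
      exact (hmem _ _).2 ⟨m + 1, (hf.mem_iff _ _).2 ⟨s, hm⟩, by simp⟩

end IsStageFunction

/-- This is the use principle: a halting computation consults only finitely many oracle values. Each
scheme that generates the functions recursive in `o` preserves the existence of a primitive
recursive monotone approximation. -/
theorem exists_isStageFunction (o : ℕ → ℕ) {f : ℕ →. ℕ}
    (hf : Nat.RecursiveIn {fun n => Part.some (o n)} f) : ∃ F, IsStageFunction o f F := by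
  induction hf with
  | zero => exact ⟨_, .of_total (Primrec.const 0)⟩
  | succ => exact ⟨_, .of_total Primrec.succ⟩
  | left => exact ⟨_, .of_total (Primrec.fst.comp Primrec.unpair)⟩
  | right => exact ⟨_, .of_total (Primrec.snd.comp Primrec.unpair)⟩
  | oracle g hg =>
    rw [Set.mem_singleton_iff.1 hg]
    exact ⟨_, .oracle⟩
  | pair _ _ ihf ihg =>
    obtain ⟨⟨F, hF⟩, G, hG⟩ := And.intro ihf ihg
    exact ⟨_, hF.pair hG⟩
  | comp _ _ ihf ihg =>
    obtain ⟨⟨F, hF⟩, G, hG⟩ := And.intro ihf ihg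
    exact ⟨_, hF.comp hG⟩
  | prec _ _ ihf ihg =>
    obtain ⟨⟨F, hF⟩, G, hG⟩ := And.intro ihf ihg
    exact ⟨_, hF.prec hG⟩
  | rfind _ ihf =>
    obtain ⟨F, hF⟩ := ihf
    exact ⟨_, hF.rfind⟩

/-- A set that is c.e. in `B` is the projection of a relation decidable in `B`. -/
theorem CEIn.exists_predIn {A B : Set ℕ} (h : CEIn B A) :
    ∃ R : ℕ → ℕ → Prop, PredIn (oracleOf B) (fun x : ℕ × ℕ => R x.1 x.2) ∧
      ∀ n, n ∈ A ↔ ∃ s, R n s := by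
  classical
  obtain ⟨f, hf, hA⟩ := h
  set o : ℕ → ℕ := fun n => if n ∈ B then 1 else 0
  have ho : charFun B = fun n => Part.some (o n) := by
    funext n
    simp [charFun, o]
  rw [TuringReducible, RecursiveIn.iff_nat, ho] at hf
  obtain ⟨F, hF⟩ := exists_isStageFunction o hf
  refine ⟨fun n s => (F n (initSeg o s)).isSome = true, ?_, fun n => ?_⟩
  · have hoc : ComputableIn (oracleOf B) o := by
      have := RecursiveIn.oracle (O := oracleOf B) (charFun B) rfl
      rw [ho] at this
      exact this
    exact PredIn.of_eq_true (ComputableIn.primrec_comp Primrec.option_isSome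
      (ComputableIn.primrec_comp₂ hF.primrec ComputableIn.fst
        (hoc.map_range.comp ComputableIn.snd)))
  · rw [hA, Part.dom_iff_mem]
    simp only [hF.mem_iff, Option.isSome_iff_exists]
    exact exists_comm

/-! ### A function computable from `A` that escapes domination. -/

/-- A set that is c.e. in `B` and computes `B`, but is not computable from `B`, computes a
monotone function that no function computable from `B` dominates. -/
theorem exists_escaping {A B : Set ℕ} (hce : CEIn B A) (hle : TuringLE B A)
    (hlt : ¬ TuringLE A B) :
    ∃ g : ℕ → ℕ, Monotone g ∧ ComputableIn (oracleOf A) g ∧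
      ∀ f : ℕ → ℕ, ComputableIn (oracleOf B) f → ∀ s₀, ∃ s ≥ s₀, f s ≤ g s := by
  obtain ⟨R, hR, hA⟩ := hce.exists_predIn
  have hAA : PredIn (oracleOf A) (· ∈ A) := turingLE_iff_predIn.1 (TuringReducible.refl _)
  -- `m k` is the stage at which `k` enters `A`, and `0` if it never does. The oracle `A` decides
  -- membership and, through `B`, the relation `R`.
  obtain ⟨m, hm, hm'⟩ := PredIn.exists_find (p := fun k s => R k s ∨ k ∉ A)
    ((predIn_of_turingLE hle hR).or (hAA.not.comp ComputableIn.fst)) fun k => by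
      by_cases hk : k ∈ A
      · obtain ⟨s, hs⟩ := (hA k).1 hk
        exact ⟨s, Or.inl hs⟩
      · exact ⟨0, Or.inr hk⟩
  refine ⟨fun n => ∑ k ∈ Finset.range (n + 1), m k, ?_, ?_, ?_⟩
  · intro a b hab
    exact Finset.sum_le_sum_of_subset (Finset.range_mono (by omega))
  · exact ComputableIn.sum_range (h := fun _ k => m k) (hm.comp ComputableIn.snd)
      ComputableIn.succ
  · intro f hf s₀
    -- If `f` exceeded the sums of `m` from `s₀` on, then every `k ∈ A` would enter before stage `f
    -- (max k s₀)`, and `B` could decide `A` by a bounded search.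
    by_contra! hdom
    apply hlt
    rw [turingLE_iff_predIn]
    have hb : ComputableIn (oracleOf B) fun k => f (max k s₀) :=
      hf.comp (Primrec.nat_max.comp Primrec.id (Primrec.const s₀)).computableIn
    refine (PredIn.exists_lt hR hb).of_iff fun k => ?_
    rw [hA]
    constructor
    · rintro ⟨s, -, hs⟩
      exact ⟨s, hs⟩
    · intro hk
      refine ⟨m k, lt_of_le_of_lt ?_ (hdom (max k s₀) (le_max_right _ _)),
        (hm' k).1.resolve_right (not_not.2 ((hA k).2 hk))⟩
      exact Finset.single_le_sum (f := m) (fun _ _ => Nat.zero_le _)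
        (Finset.mem_range.2 (by omega))

/-! ### Priority construction of a path meeting dense sets in a tree. -/

/-- The element of `α` with code `n`, and a default element if there is none. -/
def decodeD (α : Type*) [Encodable α] [Inhabited α] (n : ℕ) : α := (decode n).getD default

@[simp]
theorem decodeD_encode {α : Type*} [Encodable α] [Inhabited α] (a : α) :
    decodeD α (encode a) = a := by
  simp [decodeD, encodek]

theorem primrec_decodeD (α : Type*) [Primcodable α] [Inhabited α] : Primrec (decodeD α) :=
  Primrec.option_getD.comp Primrec.decode (Primrec.const default)

theorem primrecRel_prefix : PrimrecRel fun σ τ : List Bool => σ <+: τ :=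
  PrimrecRel.of_eq (r := fun σ τ : List Bool => σ = τ.take σ.length)
    (Primrec.eq.comp Primrec.fst
      (Primrec.list_take.comp (Primrec.list_length.comp Primrec.fst) Primrec.snd))
    fun _ _ => List.prefix_iff_eq_take.symm

/-- The set of strings `U` is dense in the tree `T`. -/
def DenseIn (T U : List Bool → Prop) : Prop :=
  ∀ σ, T σ → ∃ τ, σ <+: τ ∧ T τ ∧ U τ

/-- The string with code `n` is an extension of `σ` in `T` meeting `U`, which `σ` does not meet. -/
def IsTarget (T U : List Bool → Prop) (n : ℕ) (σ : List Bool) : Prop :=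
  ¬ U σ ∧ σ <+: decodeD (List Bool) n ∧ T (decodeD (List Bool) n) ∧ U (decodeD (List Bool) n)

/-- From every string of length `s` in `T` there is an extension in `T ∩ U` with code at
most `b`. -/
def ReachBound (T U : List Bool → Prop) (s b : ℕ) : Prop :=
  ∀ σ, T σ → σ.length = s → ∃ n ≤ b, σ <+: decodeD (List Bool) n ∧
    T (decodeD (List Bool) n) ∧ U (decodeD (List Bool) n)

theorem ReachBound.mono {T U : List Bool → Prop} {s b c : ℕ} (h : ReachBound T U s b)
    (hbc : b ≤ c) : ReachBound T U s c := fun σ hσ hs =>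
  let ⟨τ, h1, h2⟩ := h σ hσ hs
  ⟨τ, h1.trans hbc, h2⟩

section Path

variable {O : Set (ℕ →. ℕ)} {T : List Bool → Prop} {U : ℕ → List Bool → Prop} {g : ℕ → ℕ}

theorem predIn_isTarget (hT : PredIn O T) (hU : PredIn O fun x : ℕ × List Bool => U x.1 x.2) :
    PredIn O fun x : (ℕ × List Bool) × ℕ => IsTarget T (U x.1.1) x.2 x.1.2 := by
  have hs : ComputableIn O fun x : (ℕ × List Bool) × ℕ => decodeD (List Bool) x.2 :=
    ComputableIn.primrec_comp (primrec_decodeD _) ComputableIn.snd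
  have hσ : ComputableIn O fun x : (ℕ × List Bool) × ℕ => x.1.2 :=
    ComputableIn.snd.comp ComputableIn.fst
  have he : ComputableIn O fun x : (ℕ × List Bool) × ℕ => x.1.1 :=
    ComputableIn.fst.comp ComputableIn.fst
  exact (hU.comp ComputableIn.fst).not.and
    (((PredIn.of_primrec primrecRel_prefix).comp (hσ.pair hs)).and
      ((hT.comp hs).and (hU.comp (he.pair hs))))

/-- A finite-injury argument. At a string `σ`, only targets with code at most `g σ.length` are
considered, and only requirements `e ≤ σ.length`. The path is extended by one bit towards the least
target of the least requirement having one. A requirement that is never preempted again keeps its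
target until it is reached, so each requirement acts finitely often. A dense unmet requirement would
have a target within the bound at infinitely many stages, hence would have to act or be preempted
infinitely often. Density of `U e` need not be decidable: requirements without targets in the bound
are simply passed over. -/
theorem exists_path (hT : PredIn O T) (hU : PredIn O fun x : ℕ × List Bool => U x.1 x.2)
    (hg : ComputableIn O g) (hgm : Monotone g) (hnil : T [])
    (hsucc : ∀ σ, T σ → ∃ b, T (σ ++ [b])) (hpre : ∀ σ τ, σ <+: τ → T τ → T σ)
    (hUmono : ∀ e σ τ, σ <+: τ → U e σ → U e τ)
    (hreach : ∀ e, DenseIn T (U e) → ∀ s₀, ∃ s ≥ s₀, ReachBound T (U e) s (g s)) :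
    ∃ X : ℕ → Bool, ComputableIn O X ∧ (∀ s, T ((List.range s).map X)) ∧
      ∀ e, DenseIn T (U e) → ∃ s, U e ((List.range s).map X) := by
  classical
  have hlen : ComputableIn O (List.length : List Bool → ℕ) :=
    Primrec.list_length.computableIn
  obtain ⟨ν, hν, hν'⟩ := PredIn.exists_find
    (p := fun (x : ℕ × List Bool) n => IsTarget T (U x.1) n x.2 ∨ g x.2.length < n)
    ((predIn_isTarget hT hU).or ((PredIn.of_primrec Primrec.nat_lt).comp
      ((hg.comp (hlen.comp (ComputableIn.snd.comp ComputableIn.fst))).pair ComputableIn.snd)))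
    fun x => ⟨_, Or.inr (Nat.lt_succ_self _)⟩
  obtain ⟨ε, hε, hε'⟩ := PredIn.exists_find
    (p := fun (σ : List Bool) e => ν (e, σ) ≤ g σ.length ∨ σ.length < e)
    (((PredIn.of_primrec Primrec.nat_le).comp ((hν.comp
      (ComputableIn.snd.pair ComputableIn.fst)).pair (hg.comp (hlen.comp ComputableIn.fst)))).or
      ((PredIn.of_primrec Primrec.nat_lt).comp
        ((hlen.comp ComputableIn.fst).pair ComputableIn.snd)))
    fun x => ⟨_, Or.inr (Nat.lt_succ_self _)⟩
  have hνtarget : ∀ e σ, ν (e, σ) ≤ g σ.length → IsTarget T (U e) (ν (e, σ)) σ :=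
    fun e σ h => (hν' (e, σ)).1.resolve_right (by simpa using h)
  have hνle : ∀ e σ n, IsTarget T (U e) n σ → ν (e, σ) ≤ n := fun e σ n h =>
    not_lt.1 fun hlt => (hν' (e, σ)).2 n hlt (Or.inl h)
  have hεle : ∀ e σ, ν (e, σ) ≤ g σ.length → ε σ ≤ e := fun e σ h =>
    not_lt.1 fun hlt => (hε' σ).2 e hlt (Or.inl h)
  have hεν : ∀ σ, ε σ ≤ σ.length → ν (ε σ, σ) ≤ g σ.length := fun σ h =>
    (hε' σ).1.resolve_right (by simpa using h)
  -- When some requirement acts, copy the next bit of its target; otherwise take any bit that stays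
  -- in the tree.
  set next : List Bool → Bool := fun σ =>
    if ε σ ≤ σ.length then (decodeD (List Bool) (ν (ε σ, σ))).getD σ.length false
    else if T (σ ++ [false]) then false else true with hnext
  have hnextc : ComputableIn O next := by
    refine PredIn.ite ((PredIn.of_primrec Primrec.nat_le).comp (hε.pair hlen)) ?_ ?_
    · exact ComputableIn.primrec_comp₂ (f := fun (l : List Bool) n => l.getD n false)
        (Primrec.list_getD false)
        (ComputableIn.primrec_comp (primrec_decodeD _) (hν.comp (hε.pair ComputableIn.id))) hlen
    · exact PredIn.ite (hT.comp (ComputableIn.primrec_comp₂ (f := fun l x => l ++ [x])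
        Primrec.list_concat ComputableIn.id (ComputableIn.const false)))
        (ComputableIn.const _) (ComputableIn.const _)
  obtain ⟨S, hS, hSzero, hSsucc⟩ : ∃ S : ℕ → List Bool, ComputableIn O S ∧ S 0 = [] ∧
      ∀ s, S (s + 1) = S s ++ [next (S s)] :=
    ⟨fun n => Nat.rec (motive := fun _ => List Bool) [] (fun _ IH => IH ++ [next IH]) n,
      ComputableIn.nat_rec (h := fun _ p => p.2 ++ [next p.2]) ComputableIn.id
        (ComputableIn.const []) (ComputableIn.primrec_comp₂ (f := fun l x => l ++ [x])
          Primrec.list_concat (ComputableIn.snd.comp ComputableIn.snd)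
          (hnextc.comp (ComputableIn.snd.comp ComputableIn.snd))), rfl, fun _ => rfl⟩
  have hSlen : ∀ s, (S s).length = s := by
    intro s
    induction s with
    | zero => simp [hSzero]
    | succ s ih => rw [hSsucc]; simp [ih]
  have hSX : ∀ s, (List.range s).map (fun n => next (S n)) = S s := by
    intro s
    induction s with
    | zero => simp [hSzero]
    | succ s ih => rw [List.range_succ, List.map_append, ih, hSsucc]; rfl
  have hSprefix : ∀ {s t}, s ≤ t → S s <+: S t := by
    intro s t hst
    induction hst with
    | refl => exact List.prefix_rfl
    | step _ ih => exact ih.trans (by rw [hSsucc]; exact List.prefix_append _ _)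
  -- when `ε (S s) ≤ s`, the construction follows the target of requirement `ε (S s)`
  have hfollow : ∀ s, ε (S s) ≤ s → S (s + 1) <+: decodeD (List Bool) (ν (ε (S s), S s)) := by
    intro s hs
    have hs' : ε (S s) ≤ (S s).length := by rwa [hSlen]
    obtain ⟨h1, ⟨l, hl⟩, -, h4⟩ := hνtarget _ _ (hεν _ hs')
    rw [hSsucc, hnext]
    simp only [hs', if_true]
    rw [← hl] at h4 ⊢
    cases l with
    | nil => exact absurd (by simpa using h4) h1
    | cons b l =>
      rw [List.getD_append_right _ _ _ _ le_rfl]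
      simp
  have hST : ∀ s, T (S s) := by
    intro s
    induction s with
    | zero => rwa [hSzero]
    | succ s ih =>
      by_cases hs : ε (S s) ≤ s
      · exact hpre _ _ (hfollow s hs) (hνtarget _ _ (hεν _ (by rwa [hSlen]))).2.2.1
      · have hs' : ¬ ε (S s) ≤ (S s).length := by rwa [hSlen]
        rw [hSsucc, hnext]
        simp only [hs', if_false]
        split_ifs with hf
        · exact hf
        · obtain ⟨b, hb⟩ := hsucc _ ih
          cases b
          · exact absurd hb hf
          · exact hb
  -- each requirement is followed at finitely many stages only
  have hfin : ∀ e, ∃ s₀, ∀ s ≥ s₀, ε (S s) = e → s < e := by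
    intro e
    induction e using Nat.strong_induction_on with
    | _ e ih =>
      choose! s₀ hs₀ using ih
      set s₁ := ∑ i ∈ Finset.range e, s₀ i
      have hs₁ : ∀ s ≥ s₁, ∀ i < e, ε (S s) = i → s < i := fun s hs i hi =>
        hs₀ i hi s (le_trans (Finset.single_le_sum (f := s₀) (fun _ _ => Nat.zero_le _)
          (Finset.mem_range.2 hi)) hs)
      by_contra! hcon
      have hnotU : ∀ s, ¬ U e (S s) := by
        intro s hU
        obtain ⟨t, ht, hte, het⟩ := hcon s
        have := (hνtarget _ _ (hεν (S t) (by rw [hSlen, hte]; omega))).1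
        rw [hte] at this
        exact this (hUmono _ _ _ (hSprefix ht) hU)
      obtain ⟨s₂, hs₂, hse, hes⟩ := hcon s₁
      set n := ν (e, S s₂)
      -- Once all requirements before `e` have stopped acting, the target `n` is frozen: the path
      -- leads towards it, so it remains a target; it stays within the bound because `g` is
      -- monotone; and a smaller target of the longer string would already have been a target of the
      -- shorter one.
      have hkey : ∀ d, ε (S (s₂ + d)) = e ∧ ν (e, S (s₂ + d)) = n := by
        intro d
        induction d with
        | zero => exact ⟨hse, rfl⟩
        | succ d ihd =>
          obtain ⟨ih1, ih2⟩ := ihd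
          have hle := hεν (S (s₂ + d)) (by rw [ih1, hSlen]; omega)
          have htar := hνtarget _ _ hle
          have hfol := hfollow (s₂ + d) (by omega)
          rw [ih1, ih2] at htar hle hfol
          have htar' : IsTarget T (U e) n (S (s₂ + (d + 1))) :=
            ⟨hnotU (s₂ + (d + 1)), hfol, htar.2.2⟩
          have hν1 := hνle _ _ _ htar'
          have hle' : n ≤ g (S (s₂ + (d + 1))).length := by
            refine hle.trans (hgm ?_)
            rw [hSlen, hSlen]
            omega
          have htar2 := hνtarget _ _ (hν1.trans hle')
          have hν2 : n ≤ ν (e, S (s₂ + (d + 1))) := by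
            rw [← ih2]
            exact hνle _ _ _ ⟨hnotU (s₂ + d), (hSprefix (t := s₂ + (d + 1)) (by omega)).trans htar2.2.1, htar2.2.2⟩
          refine ⟨le_antisymm (hεle _ _ (hν1.trans hle')) ?_, le_antisymm hν1 hν2⟩
          by_contra! hlt
          have := hs₁ (s₂ + (d + 1)) (by omega) _ hlt rfl
          omega
      -- After as many further steps as the target has bits, the path would be a prefix of the
      -- target and longer than it.
      have h := hkey (decodeD (List Bool) n).length
      have hfol := (hfollow (s₂ + (decodeD (List Bool) n).length) (by omega)).length_le
      rw [hSlen, h.1, h.2] at hfol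
      omega
  refine ⟨fun n => next (S n), hnextc.comp hS, fun s => by rw [hSX]; exact hST s, fun e he => ?_⟩
  simp only [hSX]
  by_contra! hcon
  choose s₀ hs₀ using hfin
  -- The stage is taken past `e` and past the last action of every requirement up to `e`, yet one of
  -- these must act there.
  obtain ⟨s, hs, hsb⟩ := hreach e he (e + ∑ i ∈ Finset.range (e + 1), s₀ i)
  obtain ⟨n, h1, h2⟩ := hsb (S s) (hST s) (hSlen s)
  have hν1 : ν (e, S s) ≤ n := hνle _ _ _ ⟨hcon s, h2⟩
  have hε1 : ε (S s) ≤ e := hεle _ _ (hν1.trans (by rwa [hSlen]))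
  have := Finset.single_le_sum (f := s₀) (s := Finset.range (e + 1))
    (fun _ _ => Nat.zero_le _) (Finset.mem_range.2 (Nat.lt_succ_of_le hε1))
  have := hs₀ _ s (by omega) rfl
  omega

/-- The list of all binary strings of length `n`. -/
def stringsOfLength (n : ℕ) : List (List Bool) :=
  Nat.rec (motive := fun _ => List (List Bool)) [[]]
    (fun _ IH => IH.map (fun σ => σ ++ [false]) ++ IH.map fun σ => σ ++ [true]) n

theorem mem_stringsOfLength (σ : List Bool) : σ ∈ stringsOfLength σ.length := by
  induction σ using List.reverseRecOn with
  | nil => simp [stringsOfLength]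
  | append_singleton σ b ih =>
    rw [List.length_append, List.length_singleton]
    change _ ∈ (stringsOfLength σ.length).map _ ++ (stringsOfLength σ.length).map _
    cases b <;> simp [ih]

theorem primrec_stringsOfLength : Primrec stringsOfLength := by
  refine Primrec.nat_rec₁ (f := fun (_ : ℕ) (IH : List (List Bool)) => IH.map (fun σ => σ ++ [false]) ++
    IH.map fun σ => σ ++ [true]) _ ?_
  have h : ∀ b : Bool, Primrec fun x : ℕ × List (List Bool) => x.2.map fun σ => σ ++ [b] :=
    fun b => Primrec.list_map Primrec.snd
      (Primrec.list_concat.comp Primrec.snd (Primrec.const b))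
  exact Primrec.list_append.comp (h false) (h true)

/-- Search for an extension from every string of length `s` and add up the codes found. Density
makes each search from a string in `T` succeed; strings outside `T` contribute `0`. This is uniform
in `e` when all the sets are dense. -/
theorem exists_reachBound (hT : PredIn O T) (hU : PredIn O fun x : ℕ × List Bool => U x.1 x.2)
    (hd : ∀ e, DenseIn T (U e)) :
    ∃ f : ℕ → ℕ → ℕ, ComputableIn₂ O f ∧ ∀ e s, ReachBound T (U e) s (f e s) := by
  have hs : ComputableIn O fun x : (ℕ × List Bool) × ℕ => decodeD (List Bool) x.2 :=
    ComputableIn.primrec_comp (primrec_decodeD _) ComputableIn.snd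
  have hσ : ComputableIn O fun x : (ℕ × List Bool) × ℕ => x.1.2 :=
    ComputableIn.snd.comp ComputableIn.fst
  have he : ComputableIn O fun x : (ℕ × List Bool) × ℕ => x.1.1 :=
    ComputableIn.fst.comp ComputableIn.fst
  obtain ⟨ν, hν, hν'⟩ := PredIn.exists_find
    (p := fun (x : ℕ × List Bool) n => ¬ T x.2 ∨
      x.2 <+: decodeD (List Bool) n ∧ T (decodeD (List Bool) n) ∧ U x.1 (decodeD (List Bool) n))
    ((hT.comp hσ).not.or (((PredIn.of_primrec primrecRel_prefix).comp (hσ.pair hs)).and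
      ((hT.comp hs).and (hU.comp (he.pair hs)))))
    (by
      rintro ⟨e, σ⟩
      by_cases h : T σ
      · obtain ⟨τ, hτ⟩ := hd e σ h
        exact ⟨encode τ, Or.inr (by simpa using hτ)⟩
      · exact ⟨0, Or.inl h⟩)
  refine ⟨fun e s => ∑ i ∈ Finset.range (stringsOfLength s).length,
    ν (e, (stringsOfLength s).getI i), ?_, ?_⟩
  · refine ComputableIn.sum_range (α := ℕ × ℕ)
      (h := fun x i => ν (x.1, (stringsOfLength x.2).getI i))
      (f := fun x => (stringsOfLength x.2).length) ?_ ?_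
    · exact hν.comp ((ComputableIn.fst.comp ComputableIn.fst).pair
        (ComputableIn.primrec_comp₂ Primrec.list_getI
          (ComputableIn.primrec_comp primrec_stringsOfLength
            (ComputableIn.snd.comp ComputableIn.fst)) ComputableIn.snd))
    · exact (Primrec.list_length.comp (primrec_stringsOfLength.comp Primrec.snd)).computableIn
  · intro e s σ hσT hσs
    obtain ⟨i, hi, hi'⟩ := List.mem_iff_getElem.1 (mem_stringsOfLength σ)
    rw [hσs] at hi
    obtain ⟨h1, h2, h3⟩ := (hν' (e, σ)).1.resolve_left (not_not.2 hσT)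
    refine ⟨ν (e, σ), ?_, h1, h2, h3⟩
    have := Finset.single_le_sum (f := fun i => ν (e, (stringsOfLength s).getI i))
      (fun _ _ => Nat.zero_le _) (Finset.mem_range.2 hi)
    simp only [List.getI_eq_getElem _ hi] at this
    simp only [hσs] at hi'
    rwa [hi'] at this

end Path

/-! ### Group words and their values. -/

/-- A group word in the letters `α`: the letter `(a, true)` stands for `a`, and `(a, false)` for
its inverse. -/
abbrev GWord (α : Type*) := List (α × Bool)

/-- The value of a group word. -/
def wordEval {α G : Type*} [Group G] (v : α → G) (w : GWord α) : G :=
  FreeGroup.lift v (FreeGroup.mk w)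

section wordEval

variable {α β G H : Type*} [Group G] [Group H]

@[simp]
theorem wordEval_nil (v : α → G) : wordEval v [] = 1 := by
  simp [wordEval]

@[simp]
theorem wordEval_append (v : α → G) (w w' : GWord α) :
    wordEval v (w ++ w') = wordEval v w * wordEval v w' := by
  simp [wordEval]

@[simp]
theorem wordEval_invRev (v : α → G) (w : GWord α) :
    wordEval v (FreeGroup.invRev w) = (wordEval v w)⁻¹ := by
  rw [wordEval, ← FreeGroup.inv_mk, map_inv, wordEval]

@[simp]
theorem wordEval_singleton (v : α → G) (a : α) (b : Bool) :
    wordEval v [(a, b)] = cond b (v a) (v a)⁻¹ := by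
  simp [wordEval]

theorem wordEval_cons (v : α → G) (x : α × Bool) (w : GWord α) :
    wordEval v (x :: w) = cond x.2 (v x.1) (v x.1)⁻¹ * wordEval v w := by
  rw [← wordEval_singleton]
  exact wordEval_append v [x] w

theorem wordEval_congr {v v' : α → G} {w : GWord α} (h : ∀ x ∈ w, v x.1 = v' x.1) :
    wordEval v w = wordEval v' w := by
  induction w with
  | nil => simp
  | cons x w ih =>
    rw [wordEval_cons, wordEval_cons, h x (by simp), ih fun y hy => h y (by simp [hy])]

theorem map_wordEval (f : G →* H) (v : α → G) (w : GWord α) :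
    f (wordEval v w) = wordEval (fun a => f (v a)) w := by
  induction w with
  | nil => simp
  | cons x w ih => rw [wordEval_cons, wordEval_cons, map_mul, ih]; cases x.2 <;> simp

theorem wordEval_of (w : GWord α) : wordEval FreeGroup.of w = FreeGroup.mk w := by
  rw [wordEval, FreeGroup.lift_of_eq_id]
  rfl

theorem wordEval_eq_of_mk_eq {w w' : GWord α} (h : FreeGroup.mk w = FreeGroup.mk w')
    (v : α → G) : wordEval v w = wordEval v w' := by
  rw [wordEval, h, wordEval]

/-- Rename the letters of a group word. -/
def rename (f : α → β) (w : GWord α) : GWord β := w.map fun x => (f x.1, x.2)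

theorem wordEval_rename (f : α → β) (v : β → G) (w : GWord α) :
    wordEval v (rename f w) = wordEval (fun a => v (f a)) w := by
  induction w with
  | nil => simp [rename]
  | cons x w ih =>
    rw [wordEval_cons, ← ih, ← wordEval_cons v (f x.1, x.2)]
    rfl

theorem rename_rename {γ : Type*} (f : α → β) (g : β → γ) (w : GWord α) :
    rename g (rename f w) = rename (fun a => g (f a)) w := by
  simp [rename]

end wordEval

/-! ### Satisfiability of finite systems is decidable in the halting set. -/

/-- Some group satisfies all equations `p = 1` with `p ∈ P` and all inequations `q ≠ 1` with
`q ∈ Q`. -/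
def Satisfiable (P Q : List (GWord ℕ)) : Prop :=
  ∃ (G : Type) (_ : Group G) (v : ℕ → G),
    (∀ p ∈ P, wordEval v p = 1) ∧ ∀ q ∈ Q, wordEval v q ≠ 1

/-- The product of conjugates of members of `P` and their inverses that is described by `c`. -/
def conjProd (P : List (GWord ℕ)) (c : List (GWord ℕ × ℕ × Bool)) : GWord ℕ :=
  c.flatMap fun x => x.1 ++ (cond x.2.2 (P.getI x.2.1) (FreeGroup.invRev (P.getI x.2.1)) ++
    FreeGroup.invRev x.1)

theorem conjProd_append (P : List (GWord ℕ)) (c c' : List (GWord ℕ × ℕ × Bool)) :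
    conjProd P (c ++ c') = conjProd P c ++ conjProd P c' :=
  List.flatMap_append

theorem wordEval_conjProd {G : Type*} [Group G] {v : ℕ → G} {P : List (GWord ℕ)}
    (h : ∀ p ∈ P, wordEval v p = 1) (c : List (GWord ℕ × ℕ × Bool)) :
    wordEval v (conjProd P c) = 1 := by
  have hP : ∀ i, wordEval v (P.getI i) = 1 := by
    intro i
    rcases lt_or_ge i P.length with hi | hi
    · rw [List.getI_eq_getElem _ hi]
      exact h _ (List.getElem_mem hi)
    · rw [List.getI_eq_default _ hi]
      exact wordEval_nil v
  induction c with
  | nil => simp [conjProd]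
  | cons x c ih =>
    rw [show x :: c = [x] ++ c from rfl, conjProd_append, wordEval_append, ih]
    rcases x with ⟨w, i, _ | _⟩ <;> simp [conjProd, hP]

theorem exists_conjProd {P : List (GWord ℕ)} {x : FreeGroup ℕ}
    (hx : x ∈ Subgroup.normalClosure {y | ∃ p ∈ P, FreeGroup.mk p = y}) :
    ∃ c, FreeGroup.mk (conjProd P c) = x := by
  induction hx using Subgroup.closure_induction with
  | mem x hx =>
    obtain ⟨_, ⟨p, hp, rfl⟩, hconj⟩ := Group.mem_conjugatesOfSet_iff.1 hx
    obtain ⟨w, rfl⟩ := isConj_iff.1 hconj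
    obtain ⟨i, hi, rfl⟩ := List.mem_iff_getElem.1 hp
    refine ⟨[(w.toWord, i, true)], ?_⟩
    simp [conjProd, List.getI_eq_getElem _ hi, ← FreeGroup.mul_mk, ← FreeGroup.inv_mk,
      FreeGroup.mk_toWord, mul_assoc]
  | one => exact ⟨[], rfl⟩
  | mul x y _ _ hx hy =>
    obtain ⟨⟨c, rfl⟩, d, rfl⟩ := And.intro hx hy
    exact ⟨c ++ d, by rw [conjProd_append, FreeGroup.mul_mk]⟩
  | inv x hmem hx =>
    obtain ⟨c, rfl⟩ := hx
    clear hmem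
    -- The inverse of a product of conjugates reverses the order and inverts each relator, keeping
    -- the conjugators.
    refine ⟨(c.map fun x => (x.1, x.2.1, !x.2.2)).reverse, ?_⟩
    induction c with
    | nil => rfl
    | cons x c ih =>
      rw [List.map_cons, List.reverse_cons, conjProd_append, ← FreeGroup.mul_mk, ih,
        show x :: c = [x] ++ c from rfl, conjProd_append, ← FreeGroup.mul_mk, mul_inv_rev]
      congr 1
      rcases x with ⟨w, i, _ | _⟩ <;>
        simp [conjProd, ← FreeGroup.mul_mk, ← FreeGroup.inv_mk, mul_assoc]

/-- The group presented by the relators `P` is the universal test: if no `q` lies in the normal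
closure of `P`, this one group satisfies all the inequations at once. Hence a single `q` and an
expression of it as a product of conjugates certify unsatisfiability, which is therefore c.e. -/
theorem not_satisfiable_iff {P Q : List (GWord ℕ)} :
    ¬ Satisfiable P Q ↔
      ∃ c, ∃ q ∈ Q, FreeGroup.reduce q = FreeGroup.reduce (conjProd P c) := by
  constructor
  · intro h
    by_contra! hcon
    apply h
    set N := Subgroup.normalClosure {y | ∃ p ∈ P, FreeGroup.mk p = y}
    have hev : ∀ w : GWord ℕ, wordEval (fun i => (QuotientGroup.mk' N) (FreeGroup.of i)) w =
        (QuotientGroup.mk' N) (FreeGroup.mk w) := by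
      intro w
      rw [← map_wordEval, wordEval_of]
    refine ⟨FreeGroup ℕ ⧸ N, inferInstance, fun i => (QuotientGroup.mk' N) (FreeGroup.of i),
      fun p hp => ?_, fun q hq hq1 => ?_⟩
    · rw [hev]
      exact (QuotientGroup.eq_one_iff _).2 (Subgroup.subset_normalClosure ⟨p, hp, rfl⟩)
    · rw [hev] at hq1
      obtain ⟨c, hc⟩ := exists_conjProd ((QuotientGroup.eq_one_iff _).1 hq1)
      exact hcon c q hq (FreeGroup.reduce.sound hc.symm)
  · rintro ⟨c, q, hq, hc⟩ ⟨G, _, v, h1, h2⟩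
    apply h2 q hq
    rw [← wordEval_conjProd h1 c]
    exact wordEval_eq_of_mk_eq (FreeGroup.reduce.exact hc) v

theorem primrec_invRev : Primrec (FreeGroup.invRev : GWord ℕ → GWord ℕ) := by
  have h : Primrec₂ fun (_ : GWord ℕ) (x : ℕ × Bool) => (x.1, !x.2) :=
    Primrec.pair (Primrec.fst.comp Primrec.snd) (Primrec.not.comp (Primrec.snd.comp Primrec.snd))
  exact (Primrec.list_reverse (α := ℕ × Bool)).comp (Primrec.list_map Primrec.id h)

theorem primrec_reduce : Primrec (FreeGroup.reduce : GWord ℕ → GWord ℕ) := by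
  have hstep : Primrec₂ fun (x : ℕ × Bool) (w : GWord ℕ) =>
      (List.casesOn w [x] fun y w' =>
        if x.1 = y.1 ∧ x.2 = !y.2 then w' else x :: y :: w' : GWord ℕ) := by
    refine Primrec.list_casesOn (f := fun z : (ℕ × Bool) × GWord ℕ => z.2) (g := fun z => [z.1])
      (h := fun z y => if z.1.1 = y.1.1 ∧ z.1.2 = !y.1.2 then y.2 else z.1 :: y.1 :: y.2)
      Primrec.snd (Primrec.list_cons.comp Primrec.fst (Primrec.const [])) ?_
    have hx : Primrec fun z : ((ℕ × Bool) × GWord ℕ) × (ℕ × Bool) × GWord ℕ => z.1.1 :=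
      Primrec.fst.comp Primrec.fst
    have hy : Primrec fun z : ((ℕ × Bool) × GWord ℕ) × (ℕ × Bool) × GWord ℕ => z.2.1 :=
      Primrec.fst.comp Primrec.snd
    have hw : Primrec fun z : ((ℕ × Bool) × GWord ℕ) × (ℕ × Bool) × GWord ℕ => z.2.2 :=
      Primrec.snd.comp Primrec.snd
    exact Primrec.ite
      ((Primrec.eq.comp (Primrec.fst.comp hx) (Primrec.fst.comp hy)).and
        (Primrec.eq.comp (Primrec.snd.comp hx) (Primrec.not.comp (Primrec.snd.comp hy))))
      hw (Primrec.list_cons.comp hx (Primrec.list_cons.comp hy hw))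
  have hfold : ∀ step : ℕ × Bool → GWord ℕ → GWord ℕ, Primrec₂ step →
      Primrec fun w : GWord ℕ => w.foldr step [] := fun step h =>
    Primrec.list_foldr (h := fun _ x => step x.1 x.2) Primrec.id (Primrec.const [])
      (h.comp (Primrec.fst.comp Primrec.snd) (Primrec.snd.comp Primrec.snd))
  refine (hfold _ hstep).of_eq fun w => ?_
  induction w with
  | nil => rfl
  | cons x w ih => rw [List.foldr_cons, ih]; rfl

theorem primrec_conjProd : Primrec₂ conjProd := by
  refine Primrec.list_flatMap Primrec.snd ?_
  have hP : Primrec fun z : (List (GWord ℕ) × List (GWord ℕ × ℕ × Bool)) × GWord ℕ × ℕ × Bool =>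
      z.1.1.getI z.2.2.1 :=
    Primrec.list_getI.comp (Primrec.fst.comp Primrec.fst)
      (Primrec.fst.comp (Primrec.snd.comp Primrec.snd))
  have hw : Primrec fun z : (List (GWord ℕ) × List (GWord ℕ × ℕ × Bool)) × GWord ℕ × ℕ × Bool =>
      z.2.1 := Primrec.fst.comp Primrec.snd
  exact Primrec.list_append.comp hw (Primrec.list_append.comp
    (Primrec.cond (Primrec.snd.comp (Primrec.snd.comp Primrec.snd)) hP (primrec_invRev.comp hP))
    (primrec_invRev.comp hw))

theorem rePred_exists {α β : Type*} [Primcodable α] [Primcodable β] {r : α → β → Prop}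
    (hr : PrimrecRel r) : REPred fun a => ∃ b, r a b := by
  classical
  have h : Primrec₂ fun (a : α) (n : ℕ) =>
      (Option.casesOn (decode n : Option β) false fun b => decide (r a b) : Bool) :=
    Primrec.option_casesOn (Primrec.decode.comp Primrec.snd) (Primrec.const false)
      (hr.decide.comp (Primrec.fst.comp Primrec.fst) Primrec.snd)
  refine (Partrec.rfind h.to_comp.partrec₂).dom_re.of_eq fun a => ?_
  rw [Nat.rfind_dom]
  constructor
  · rintro ⟨n, hn, -⟩
    have hn' := Part.mem_some_iff.1 hn
    rcases hd : (decode n : Option β) with _ | b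
    · simp [hd] at hn'
    · exact ⟨b, by simpa [hd] using hn'⟩
  · rintro ⟨b, hb⟩
    exact ⟨encode b, Part.mem_some_iff.2 (by simp [encodek, hb]), fun _ => trivial⟩

theorem predIn_satisfiable :
    PredIn (oracleOf zeroJump) fun x : List (GWord ℕ) × List (GWord ℕ) => Satisfiable x.1 x.2 := by
  have h : PrimrecRel fun (x : List (GWord ℕ) × List (GWord ℕ))
      (c : List (GWord ℕ × ℕ × Bool)) =>
        ∃ q ∈ x.2, FreeGroup.reduce q = FreeGroup.reduce (conjProd x.1 c) := by
    have hR : PrimrecRel fun (q w : GWord ℕ) => FreeGroup.reduce q = FreeGroup.reduce w :=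
      Primrec.eq.comp (primrec_reduce.comp Primrec.fst) (primrec_reduce.comp Primrec.snd)
    exact hR.exists_mem_list.comp (Primrec.snd.comp Primrec.fst)
      (primrec_conjProd.comp (Primrec.fst.comp Primrec.fst) Primrec.snd)
  refine (predIn_zeroJump_of_rePred (rePred_exists h)).not.of_iff fun x => ?_
  rw [← not_satisfiable_iff, not_not]

/-! ### Terms and quantifier-free formulas in terms of words. -/

open FirstOrder

section Words

variable {α G H : Type*} [Group G] [Group H]

/-- The group word described by a term. -/
def termWord : LGroup.Term α → GWord α
  | .var a => [(a, true)]
  | .func GroupFunc.one _ => []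
  | .func GroupFunc.inv t => FreeGroup.invRev (termWord (t 0))
  | .func GroupFunc.mul t => termWord (t 0) ++ termWord (t 1)

theorem realize_termWord (v : α → G) (t : LGroup.Term α) :
    t.realize v = wordEval v (termWord t) := by
  induction t with
  | var a => simp [termWord]
  | func f t ih =>
    rw [Language.Term.realize_func]
    cases f with
    | one => rw [termWord, wordEval_nil]; rfl
    | inv => rw [termWord, wordEval_invRev, ← ih]; rfl
    | mul => rw [termWord, wordEval_append, ← ih, ← ih]; rfl

/-- A term for a group word. -/
def wordTerm : GWord α → LGroup.Term α
  | [] => .func GroupFunc.one ![]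
  | (a, true) :: w => .func GroupFunc.mul ![.var a, wordTerm w]
  | (a, false) :: w => .func GroupFunc.mul ![.func GroupFunc.inv ![.var a], wordTerm w]

@[simp]
theorem termWord_wordTerm (w : GWord α) : termWord (wordTerm w) = w := by
  induction w with
  | nil => rfl
  | cons x w ih =>
    rcases x with ⟨a, _ | _⟩ <;> · conv_rhs => rw [← ih]
                                   rfl

theorem realize_wordTerm (v : α → G) (w : GWord α) :
    (wordTerm w).realize v = wordEval v w := by
  rw [realize_termWord, termWord_wordTerm]

/-- The words `s * t⁻¹` for the equations `s = t` that occur in a formula outside of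
quantifiers. -/
def atomWords : {n : ℕ} → LGroup.BoundedFormula α n → List (GWord (α ⊕ Fin n))
  | _, .falsum => []
  | _, .equal s t => [termWord s ++ FreeGroup.invRev (termWord t)]
  | _, .rel r _ => Empty.elim r
  | _, .imp φ ψ => atomWords φ ++ atomWords ψ
  | _, .all _ => []

theorem realize_equal_iff {n : ℕ} (s t : LGroup.Term (α ⊕ Fin n)) (v : α → G) (xs : Fin n → G) :
    (Language.BoundedFormula.equal s t).Realize v xs ↔
      wordEval (Sum.elim v xs) (termWord s ++ FreeGroup.invRev (termWord t)) = 1 := by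
  rw [wordEval_append, wordEval_invRev, ← realize_termWord, ← realize_termWord,
    mul_inv_eq_one]
  rfl

/-- A quantifier-free formula is a Boolean combination of equations, so only the triviality of
finitely many words matters. This allows systems of equations and inequations to stand in for
arbitrary quantifier-free formulas. -/
theorem realize_iff_of_atomWords {n : ℕ} {φ : LGroup.BoundedFormula α n} (hφ : φ.IsQF)
    {v : α → G} {xs : Fin n → G} {v' : α → H} {xs' : Fin n → H}
    (h : ∀ w ∈ atomWords φ,
      wordEval (Sum.elim v xs) w = 1 ↔ wordEval (Sum.elim v' xs') w = 1) :
    φ.Realize v xs ↔ φ.Realize v' xs' := by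
  induction hφ with
  | falsum => exact Iff.rfl
  | of_isAtomic hat =>
    cases hat with
    | equal s t =>
      have := h _ (List.mem_singleton.2 rfl)
      exact (realize_equal_iff s t v xs).trans (this.trans (realize_equal_iff s t v' xs').symm)
    | rel r _ => exact r.elim
  | imp _ _ ih₁ ih₂ =>
    rw [Language.BoundedFormula.realize_imp, Language.BoundedFormula.realize_imp,
      ih₁ fun w hw => h w (List.mem_append_left _ hw),
      ih₂ fun w hw => h w (List.mem_append_right _ hw)]

theorem wordEval_sumElim_fin_zero (v : α → G) (xs : Fin 0 → G) (w : GWord (α ⊕ Fin 0)) :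
    wordEval (Sum.elim v xs) w = wordEval v (rename (Sum.elim id Fin.elim0) w) := by
  rw [wordEval_rename]
  congr 1
  funext x
  rcases x with i | i
  · rfl
  · exact i.elim0

theorem qfType_eq_of_wordEval {k : ℕ} {a : Fin k → G} {b : Fin k → H}
    (h : ∀ w : GWord (Fin k), wordEval a w = 1 ↔ wordEval b w = 1) : qfType a = qfType b := by
  ext φ
  refine and_congr_right fun hφ => realize_iff_of_atomWords hφ fun w _ => ?_
  rw [wordEval_sumElim_fin_zero, wordEval_sumElim_fin_zero]
  exact h _

end Words

/-! ### Gödel numbers: the diagram and the word problem compute each other. -/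

section CourseOfValues

variable {σ : Type*}

/-- The function defined from `g` by course-of-values recursion: its value at `n` is the value
of `g` on the list of the values before `n`. -/
def courseRec (g : List σ → σ) (n : ℕ) : σ :=
  g (Nat.rec (motive := fun _ => List σ) [] (fun _ IH => IH ++ [g IH]) n)

theorem courseRec_eq (g : List σ → σ) (n : ℕ) :
    courseRec g n = g ((List.range n).map (courseRec g)) := by
  rw [courseRec]
  congr 1
  induction n with
  | zero => rfl
  | succ n ih =>
    rw [List.range_succ, List.map_append, ← ih]
    rfl

theorem computableIn_courseRec [Primcodable σ] {O : Set (ℕ →. ℕ)} {g : List σ → σ}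
    (hg : ComputableIn O g) : ComputableIn O (courseRec g) :=
  ComputableIn.nat_strong_rec _ hg fun n => (courseRec_eq g n).symm

theorem getI_map_range [Inhabited σ] (f : ℕ → σ) {m n : ℕ} (h : m < n) :
    ((List.range n).map f).getI m = f m := by
  rw [List.getI_eq_getElem _ (by simpa using h)]
  simp

end CourseOfValues

section Codes

theorem lt_pair_right {a b : ℕ} (ha : 0 < a) : b < Nat.pair a b := by
  have := Nat.add_le_pair a b
  omega

/-- One step of decoding the Gödel number of a term to a group word. -/
def decodeTermStep (L : List (Option (GWord ℕ))) : Option (GWord ℕ) :=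
  if L.length.unpair.1 = 0 then some [(L.length.unpair.2, true)]
  else if L.length.unpair.1 = 2 ∧ L.length.unpair.2 = 0 then some []
  else if L.length.unpair.1 = 3 then (L.getI L.length.unpair.2).map FreeGroup.invRev
  else if L.length.unpair.1 = 4 then
    (L.getI L.length.unpair.2.unpair.1).bind fun w =>
      (L.getI L.length.unpair.2.unpair.2).map fun w' => w ++ w'
  else none

/-- The group word of the term with a given Gödel number, if there is one. -/
def decodeTerm : ℕ → Option (GWord ℕ) := courseRec decodeTermStep

theorem primrec_decodeTermStep : Primrec decodeTermStep := by
  have hu : Primrec fun L : List (Option (GWord ℕ)) => L.length.unpair :=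
    Primrec.unpair.comp Primrec.list_length
  have h1 := Primrec.fst.comp hu
  have h2 := Primrec.snd.comp hu
  have h21 := Primrec.fst.comp (Primrec.unpair.comp h2)
  have h22 := Primrec.snd.comp (Primrec.unpair.comp h2)
  have heq : ∀ c : ℕ, PrimrecPred fun L : List (Option (GWord ℕ)) => L.length.unpair.1 = c :=
    fun c => Primrec.eq.comp h1 (Primrec.const c)
  refine Primrec.ite (heq 0) ?_ (Primrec.ite ((heq 2).and (Primrec.eq.comp h2 (Primrec.const 0)))
    (Primrec.const _) (Primrec.ite (heq 3) ?_ (Primrec.ite (heq 4) ?_ (Primrec.const _))))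
  · exact Primrec.option_some.comp (Primrec.list_cons.comp (Primrec.pair h2 (Primrec.const true))
      (Primrec.const []))
  · exact Primrec.option_map (Primrec.list_getI.comp Primrec.id h2)
      (primrec_invRev.comp Primrec.snd)
  · refine Primrec.option_bind (Primrec.list_getI.comp Primrec.id h21) ?_
    exact Primrec.option_map ((Primrec.list_getI.comp Primrec.id h22).comp Primrec.fst)
      (Primrec.list_append.comp (Primrec.snd.comp Primrec.fst) Primrec.snd)

theorem decodeTerm_eq (a b : ℕ) :
    decodeTerm (Nat.pair a b) =
      if a = 0 then some [(b, true)]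
      else if a = 2 ∧ b = 0 then some []
      else if a = 3 then (decodeTerm b).map FreeGroup.invRev
      else if a = 4 then
        (decodeTerm b.unpair.1).bind fun w => (decodeTerm b.unpair.2).map fun w' => w ++ w'
      else none := by
  have hrec : decodeTerm (Nat.pair a b) =
      decodeTermStep ((List.range (Nat.pair a b)).map decodeTerm) := courseRec_eq _ _
  rw [hrec, decodeTermStep]
  simp only [List.length_map, List.length_range, Nat.unpair_pair]
  split_ifs with h0 h2 h3 h4
  · rfl
  · rfl
  · rw [getI_map_range _ (lt_pair_right (Nat.pos_of_ne_zero h0))]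
  · have hb := lt_pair_right (b := b) (Nat.pos_of_ne_zero h0)
    rw [getI_map_range _ ((Nat.unpair_left_le b).trans_lt hb),
      getI_map_range _ ((Nat.unpair_right_le b).trans_lt hb)]
  · rfl

theorem decodeTerm_termCode (t : LGroup.Term (ℕ ⊕ Fin 0)) :
    decodeTerm (termCode t) = some (rename (Sum.elim id Fin.elim0) (termWord t)) := by
  induction t with
  | var x =>
    rcases x with i | i
    · rw [termCode, decodeTerm_eq, if_pos rfl]
      rfl
    · exact i.elim0
  | func f t ih =>
    cases f with
    | one => rw [termCode, decodeTerm_eq]; rfl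
    | inv =>
      rw [termCode, decodeTerm_eq, ih]
      simp [termWord, rename, FreeGroup.invRev]
    | mul =>
      rw [termCode, decodeTerm_eq]
      simp [termWord, rename, ih]

/-- The decoder must reject numbers that code no term without bound variables; in particular
`Nat.pair 1 b` is rejected because there are no letters in `Fin 0`. -/
theorem exists_termCode_eq {n : ℕ} (h : (decodeTerm n).isSome) :
    ∃ t : LGroup.Term (ℕ ⊕ Fin 0), termCode t = n := by
  induction n using Nat.strong_induction_on with
  | _ n ih =>
    obtain ⟨⟨a, b⟩, rfl⟩ : ∃ p : ℕ × ℕ, Nat.pair p.1 p.2 = n := ⟨n.unpair, Nat.pair_unpair n⟩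
    simp only [decodeTerm_eq] at h
    split_ifs at h with h0 h2 h3 h4
    · subst h0
      exact ⟨.var (.inl b), by rw [termCode]⟩
    · obtain ⟨rfl, rfl⟩ := h2
      exact ⟨.func GroupFunc.one ![], by rw [termCode]⟩
    · subst h3
      obtain ⟨t, rfl⟩ := ih b (lt_pair_right (by omega)) (by simpa using h)
      exact ⟨.func GroupFunc.inv ![t], by rw [termCode]; rfl⟩
    · subst h4
      have hb := lt_pair_right (a := 4) (b := b) (by omega)
      have hsome : (decodeTerm b.unpair.1).isSome ∧ (decodeTerm b.unpair.2).isSome := by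
        rcases h1 : decodeTerm b.unpair.1 <;> rcases h2 : decodeTerm b.unpair.2 <;>
          simp [h1, h2] at h ⊢
      obtain ⟨s, hs⟩ := ih _ ((Nat.unpair_left_le b).trans_lt hb) hsome.1
      obtain ⟨t, ht⟩ := ih _ ((Nat.unpair_right_le b).trans_lt hb) hsome.2
      refine ⟨.func GroupFunc.mul ![s, t], ?_⟩
      rw [termCode]
      simp [hs, ht]
    · simp at h

/-- One step of evaluating the formula with a given Gödel number, where `X` decides which words
are trivial. -/
def evalFormulaStep (X : GWord ℕ → Bool) (L : List (Option Bool)) : Option Bool :=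
  if L.length.unpair.1 = 0 ∧ L.length.unpair.2 = 0 then some false
  else if L.length.unpair.1 = 1 ∧ (decodeTerm L.length.unpair.2.unpair.1).isSome = true ∧
      (decodeTerm L.length.unpair.2.unpair.2).isSome = true then
    some (X ((decodeTerm L.length.unpair.2.unpair.1).getD [] ++
      FreeGroup.invRev ((decodeTerm L.length.unpair.2.unpair.2).getD [])))
  else if L.length.unpair.1 = 2 then
    (L.getI L.length.unpair.2.unpair.1).bind fun p =>
      (L.getI L.length.unpair.2.unpair.2).map fun q => !p || q
  else none

/-- The truth value of the quantifier-free formula with a given Gödel number, if there is one. -/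
def evalFormula (X : GWord ℕ → Bool) : ℕ → Option Bool := courseRec (evalFormulaStep X)

theorem computableIn_evalFormula {O : Set (ℕ →. ℕ)} {X : GWord ℕ → Bool} (hX : ComputableIn O X) :
    ComputableIn O (evalFormula X) := by
  apply computableIn_courseRec
  have hD : ComputableIn O decodeTerm := computableIn_courseRec primrec_decodeTermStep.computableIn
  have hu : Primrec fun L : List (Option Bool) => L.length.unpair :=
    Primrec.unpair.comp Primrec.list_length
  have h1 := Primrec.fst.comp hu
  have h2 := Primrec.snd.comp hu
  have h21 := Primrec.fst.comp (Primrec.unpair.comp h2)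
  have h22 := Primrec.snd.comp (Primrec.unpair.comp h2)
  have heq : ∀ c : ℕ, PrimrecPred fun L : List (Option Bool) => L.length.unpair.1 = c :=
    fun c => Primrec.eq.comp h1 (Primrec.const c)
  have hD1 := hD.comp h21.computableIn
  have hD2 := hD.comp h22.computableIn
  have hgetD : Primrec fun o : Option (GWord ℕ) => o.getD [] :=
    Primrec.option_getD.comp Primrec.id (Primrec.const [])
  have hsome : ∀ {f : List (Option Bool) → Option (GWord ℕ)}, ComputableIn O f →
      PredIn O fun L => (f L).isSome = true := fun hf =>
    PredIn.of_eq_true (ComputableIn.primrec_comp Primrec.option_isSome hf)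
  have hatom : ∀ {f g : List (Option Bool) → Option (GWord ℕ)}, ComputableIn O f →
      ComputableIn O g → ComputableIn O fun L =>
        some (X ((f L).getD [] ++ FreeGroup.invRev ((g L).getD []))) := fun hf hg =>
    ComputableIn.primrec_comp Primrec.option_some (hX.comp
      (ComputableIn.primrec_comp₂ Primrec.list_append (ComputableIn.primrec_comp hgetD hf)
        (ComputableIn.primrec_comp primrec_invRev (ComputableIn.primrec_comp hgetD hg))))
  have himp : Primrec fun L : List (Option Bool) => (L.getI L.length.unpair.2.unpair.1).bind
      fun p => (L.getI L.length.unpair.2.unpair.2).map fun q => !p || q := by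
    refine Primrec.option_bind (Primrec.list_getI.comp Primrec.id h21) ?_
    exact Primrec.option_map ((Primrec.list_getI.comp Primrec.id h22).comp Primrec.fst)
      (Primrec.or.comp (Primrec.not.comp (Primrec.snd.comp Primrec.fst)) Primrec.snd)
  exact PredIn.ite (PredIn.of_primrec ((heq 0).and (Primrec.eq.comp h2 (Primrec.const 0))))
    (ComputableIn.const _)
    (PredIn.ite ((PredIn.of_primrec (heq 1)).and ((hsome hD1).and (hsome hD2))) (hatom hD1 hD2)
      (PredIn.ite (PredIn.of_primrec (heq 2)) himp.computableIn (ComputableIn.const _)))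

theorem evalFormula_eq (X : GWord ℕ → Bool) (a b : ℕ) :
    evalFormula X (Nat.pair a b) =
      if a = 0 ∧ b = 0 then some false
      else if a = 1 ∧ (decodeTerm b.unpair.1).isSome = true ∧
          (decodeTerm b.unpair.2).isSome = true then
        some (X ((decodeTerm b.unpair.1).getD [] ++
          FreeGroup.invRev ((decodeTerm b.unpair.2).getD [])))
      else if a = 2 then
        (evalFormula X b.unpair.1).bind fun p => (evalFormula X b.unpair.2).map fun q => !p || q
      else none := by
  have hrec : evalFormula X (Nat.pair a b) =
      evalFormulaStep X ((List.range (Nat.pair a b)).map (evalFormula X)) := courseRec_eq _ _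
  rw [hrec, evalFormulaStep]
  simp only [List.length_map, List.length_range, Nat.unpair_pair]
  split_ifs with h0 h1 h2
  · rfl
  · rfl
  · have hb := lt_pair_right (a := a) (b := b) (by omega)
    rw [getI_map_range _ ((Nat.unpair_left_le b).trans_lt hb),
      getI_map_range _ ((Nat.unpair_right_le b).trans_lt hb)]
  · rfl

theorem exists_formulaCode_eq {X : GWord ℕ → Bool} {n : ℕ} (h : (evalFormula X n).isSome) :
    ∃ φ : LGroup.Formula ℕ, φ.IsQF ∧ formulaCode φ = n := by
  induction n using Nat.strong_induction_on with
  | _ n ih =>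
    obtain ⟨⟨a, b⟩, rfl⟩ : ∃ p : ℕ × ℕ, Nat.pair p.1 p.2 = n := ⟨n.unpair, Nat.pair_unpair n⟩
    simp only [evalFormula_eq] at h
    split_ifs at h with h0 h1 h2
    · obtain ⟨rfl, rfl⟩ := h0
      exact ⟨.falsum, .falsum, by rw [formulaCode]⟩
    · obtain ⟨rfl, hs, ht⟩ := h1
      obtain ⟨s, hs⟩ := exists_termCode_eq hs
      obtain ⟨t, ht⟩ := exists_termCode_eq ht
      refine ⟨.equal s t, .of_isAtomic (.equal s t), ?_⟩
      rw [formulaCode, hs, ht, Nat.pair_unpair]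
    · subst h2
      have hb := lt_pair_right (a := 2) (b := b) (by omega)
      have hsome : (evalFormula X b.unpair.1).isSome ∧ (evalFormula X b.unpair.2).isSome := by
        rcases h1 : evalFormula X b.unpair.1 <;> rcases h2 : evalFormula X b.unpair.2 <;>
          simp [h1, h2] at h ⊢
      obtain ⟨φ, hφ, hφ'⟩ := ih _ ((Nat.unpair_left_le b).trans_lt hb) hsome.1
      obtain ⟨ψ, hψ, hψ'⟩ := ih _ ((Nat.unpair_right_le b).trans_lt hb) hsome.2
      refine ⟨.imp φ ψ, .imp hφ hψ, ?_⟩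
      rw [formulaCode, hφ', hψ', Nat.pair_unpair]
    · simp at h

variable {M : Type*} [Group M] {e : ℕ → M} {X : GWord ℕ → Bool}

theorem evalFormula_formulaCode (hX : ∀ w, X w = true ↔ wordEval e w = 1)
    {φ : LGroup.Formula ℕ} (hφ : φ.IsQF) :
    ∃ b, evalFormula X (formulaCode φ) = some b ∧ (b = true ↔ φ.Realize e) := by
  induction hφ with
  | falsum => exact ⟨false, by rw [formulaCode, evalFormula_eq]; simp, by simp; exact id⟩
  | of_isAtomic hat =>
    cases hat with
    | equal s t =>
      refine ⟨X (rename (Sum.elim id Fin.elim0) (termWord s) ++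
        FreeGroup.invRev (rename (Sum.elim id Fin.elim0) (termWord t))), by
        change evalFormula X (formulaCode (Language.BoundedFormula.equal s t)) = _
        rw [formulaCode, evalFormula_eq]
        simp only [Nat.unpair_pair, decodeTerm_termCode]
        simp, ?_⟩
      rw [hX]
      refine Iff.trans ?_ (realize_equal_iff s t e default).symm
      rw [wordEval_sumElim_fin_zero]
      simp [rename, FreeGroup.invRev, Function.comp_def]
    | rel r _ => exact r.elim
  | @imp φ ψ _ _ ih₁ ih₂ =>
    obtain ⟨p, hp, hp'⟩ := ih₁
    obtain ⟨q, hq, hq'⟩ := ih₂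
    refine ⟨!p || q, ?_, ?_⟩
    · rw [formulaCode, evalFormula_eq]
      simp [hp, hq]
    · rw [Language.Formula.Realize, Language.BoundedFormula.realize_imp]
      refine Iff.trans ?_ (imp_congr hp' hq')
      cases p <;> simp

theorem mem_qfDiagram_iff (hX : ∀ w, X w = true ↔ wordEval e w = 1) {n : ℕ} :
    n ∈ qfDiagram e ↔ evalFormula X n = some true := by
  constructor
  · rintro ⟨φ, ⟨hφ, hr⟩, rfl⟩
    obtain ⟨b, hb, hb'⟩ := evalFormula_formulaCode hX hφ
    rw [hb, hb'.2 hr]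
  · intro h
    obtain ⟨φ, hφ, rfl⟩ := exists_formulaCode_eq (X := X) (by rw [h]; rfl)
    obtain ⟨b, hb, hb'⟩ := evalFormula_formulaCode hX hφ
    rw [h, Option.some.injEq] at hb
    exact ⟨φ, ⟨hφ, hb'.1 hb.symm⟩, rfl⟩

theorem predIn_qfDiagram {O : Set (ℕ →. ℕ)} (h : PredIn O fun w : GWord ℕ => wordEval e w = 1) :
    PredIn O (· ∈ qfDiagram e) := by
  obtain ⟨X, hX, hX'⟩ := h
  refine ((PredIn.of_primrec (Primrec.eq (α := Option Bool))).comp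
    ((computableIn_evalFormula hX).pair (ComputableIn.const (some true)))).of_iff fun n => ?_
  exact (mem_qfDiagram_iff hX').symm

/-- The Gödel number of a term for the word `w`. -/
def wordTermCode (w : GWord ℕ) : ℕ :=
  w.foldr (fun x c => Nat.pair 4 (Nat.pair
    (cond x.2 (Nat.pair 0 x.1) (Nat.pair 3 (Nat.pair 0 x.1))) c)) (Nat.pair 2 0)

theorem termCode_wordTerm (w : GWord ℕ) :
    termCode (wordTerm (rename Sum.inl w) : LGroup.Term (ℕ ⊕ Fin 0)) = wordTermCode w := by
  induction w with
  | nil => rfl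
  | cons x w ih =>
    rcases x with ⟨i, _ | _⟩ <;>
    · rw [wordTermCode, List.foldr_cons, ← wordTermCode, ← ih]
      rfl

theorem decodeTerm_wordTermCode (w : GWord ℕ) : decodeTerm (wordTermCode w) = some w := by
  rw [← termCode_wordTerm, decodeTerm_termCode, termWord_wordTerm, rename_rename]
  simp [rename]

theorem primrec_wordTermCode : Primrec wordTermCode := by
  have hp : ∀ {α : Type} [Primcodable α] (c : ℕ) {f : α → ℕ}, Primrec f →
      Primrec fun a => Nat.pair c (f a) := fun {α} _ c {f} hf =>
    Primrec₂.natPair.comp (Primrec.const c) hf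
  have hx : Primrec fun z : GWord ℕ × (ℕ × Bool) × ℕ => z.2.1 := Primrec.fst.comp Primrec.snd
  have hi := hp 0 (Primrec.fst.comp hx)
  refine Primrec.list_foldr (f := fun w : GWord ℕ => w) (h := fun _ z => Nat.pair 4 (Nat.pair
    (cond z.1.2 (Nat.pair 0 z.1.1) (Nat.pair 3 (Nat.pair 0 z.1.1))) z.2))
    Primrec.id (Primrec.const _) ?_
  exact hp 4 (Primrec₂.natPair.comp (Primrec.cond (Primrec.snd.comp hx) hi (hp 3 hi))
    (Primrec.snd.comp Primrec.snd))

/-- Ask the diagram about the equation between a term for `w` and the constant term `1`. -/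
theorem predIn_wordEval {O : Set (ℕ →. ℕ)} (h : PredIn O (· ∈ qfDiagram e)) :
    PredIn O fun w : GWord ℕ => wordEval e w = 1 := by
  classical
  have hc : Primrec fun w : GWord ℕ =>
      Nat.pair 1 (Nat.pair (wordTermCode w) (wordTermCode [])) :=
    Primrec₂.natPair.comp (Primrec.const 1)
      (Primrec₂.natPair.comp primrec_wordTermCode (Primrec.const _))
  refine (h.comp hc.computableIn).of_iff fun w => ?_
  rw [mem_qfDiagram_iff (X := fun w => decide (wordEval e w = 1)) (by simp)]
  rw [evalFormula_eq]
  simp [decodeTerm_wordTermCode]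

end Codes

theorem exists_forall_mem_lt (l : List ℕ) : ∃ n, ∀ x ∈ l, x < n :=
  ⟨l.sum + 1, fun _ hx => Nat.lt_succ_of_le (List.le_sum_of_mem hx)⟩

theorem exists_letters_lt (l : List (GWord ℕ)) : ∃ n, ∀ w ∈ l, ∀ x ∈ w, x.1 < n := by
  obtain ⟨n, hn⟩ := exists_forall_mem_lt (l.flatten.map Prod.fst)
  exact ⟨n, fun w hw x hx => hn _ (List.mem_map_of_mem (List.mem_flatten.2 ⟨w, hw, hx⟩))⟩

/-! ### The tree of initial segments of word diagrams. -/

section Diagrams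

open Classical in
/-- The binary string of length `s` that lists which of the first `s` words are trivial in a group
with marked elements `v`. -/
noncomputable def wordDiagram {G : Type*} [Group G] (v : ℕ → G) (s : ℕ) : List Bool :=
  (List.range s).map fun i => decide (wordEval v (decodeD (GWord ℕ) i) = 1)

variable {G : Type*} [Group G] {v : ℕ → G}

@[simp]
theorem length_wordDiagram (s : ℕ) : (wordDiagram v s).length = s := by
  simp [wordDiagram]

theorem wordDiagram_congr {H : Type*} [Group H] {v' : ℕ → H} {s : ℕ}
    (h : ∀ w, wordEval v w = 1 ↔ wordEval v' w = 1) : wordDiagram v s = wordDiagram v' s := by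
  classical
  refine List.map_congr_left fun i _ => ?_
  rw [Bool.eq_iff_iff, decide_eq_true_iff, decide_eq_true_iff]
  exact h _

theorem wordDiagram_prefix {s t : ℕ} (h : s ≤ t) : wordDiagram v s <+: wordDiagram v t := by
  obtain ⟨d, rfl⟩ := Nat.exists_eq_add_of_le h
  rw [wordDiagram, wordDiagram, List.range_add, List.map_append]
  exact List.prefix_append _ _

theorem wordDiagram_getElem?_encode {s : ℕ} {w : GWord ℕ} {b : Bool} :
    (wordDiagram v s)[encode w]? = some b ↔
      encode w < s ∧ (b = true ↔ wordEval v w = 1) := by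
  classical
  rcases lt_or_ge (encode w) s with h | h
  · rw [wordDiagram, List.getElem?_map, List.getElem?_range h]
    cases b <;> simp [h]
  · rw [List.getElem?_eq_none (by simpa using h)]
    simp [h]

theorem wordDiagram_eq_iff {σ : List Bool} :
    wordDiagram v σ.length = σ ↔
      ∀ i < σ.length, (σ.getI i = true ↔ wordEval v (decodeD (GWord ℕ) i) = 1) := by
  classical
  constructor
  · intro h i hi
    rw [← h, wordDiagram, getI_map_range _ hi, decide_eq_true_iff]
  · intro h
    refine List.ext_getElem (by simp) fun i h1 h2 => ?_
    have := h i h2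
    rw [List.getI_eq_getElem _ h2] at this
    rw [Bool.eq_iff_iff, this]
    simp [wordDiagram]

/-- The binary strings that are initial segments of the word diagram of some marked group. -/
def IsConsistent (σ : List Bool) : Prop :=
  ∃ (G : Type) (_ : Group G) (v : ℕ → G), wordDiagram v σ.length = σ

theorem isConsistent_wordDiagram {G : Type} [Group G] (v : ℕ → G) (s : ℕ) :
    IsConsistent (wordDiagram v s) :=
  ⟨G, _, v, by rw [length_wordDiagram]⟩

theorem isConsistent_nil : IsConsistent [] :=
  ⟨Unit, inferInstance, fun _ => 1, rfl⟩

theorem IsConsistent.exists_concat {σ : List Bool} (h : IsConsistent σ) :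
    ∃ b, IsConsistent (σ ++ [b]) := by
  obtain ⟨G, _, v, h⟩ := h
  have := isConsistent_wordDiagram v (σ.length + 1)
  rw [wordDiagram, List.range_succ, List.map_append, ← wordDiagram, h] at this
  exact ⟨_, this⟩

theorem IsConsistent.of_prefix {σ τ : List Bool} (hστ : σ <+: τ) (h : IsConsistent τ) :
    IsConsistent σ := by
  obtain ⟨G, _, v, h⟩ := h
  refine ⟨G, ‹Group G›, v, ?_⟩
  have h1 : wordDiagram v σ.length <+: τ := by
    rw [← h]
    exact wordDiagram_prefix hστ.length_le
  exact (List.prefix_of_prefix_length_le h1 hστ (by simp)).eq_of_length (by simp)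

/-- The words that `σ` declares to be trivial (`b = true`) or nontrivial (`b = false`). -/
def declaredWords (b : Bool) (σ : List Bool) : List (GWord ℕ) :=
  (List.range σ.length).flatMap fun i => if σ.getI i = b then [decodeD (GWord ℕ) i] else []

theorem mem_declaredWords {b : Bool} {σ : List Bool} {w : GWord ℕ} :
    w ∈ declaredWords b σ ↔ ∃ i < σ.length, σ.getI i = b ∧ decodeD (GWord ℕ) i = w := by
  simp only [declaredWords, List.mem_flatMap, List.mem_range]
  refine exists_congr fun i => and_congr_right fun _ => ?_
  split_ifs with h <;> simp [h, eq_comm]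

theorem wordDiagram_eq_iff_declaredWords {σ : List Bool} :
    wordDiagram v σ.length = σ ↔ (∀ p ∈ declaredWords true σ, wordEval v p = 1) ∧
      ∀ q ∈ declaredWords false σ, wordEval v q ≠ 1 := by
  simp only [wordDiagram_eq_iff, mem_declaredWords]
  constructor
  · intro h
    constructor
    · rintro _ ⟨i, hi, hb, rfl⟩
      exact (h i hi).1 hb
    · rintro _ ⟨i, hi, hb, rfl⟩ h1
      rw [(h i hi).2 h1] at hb
      cases hb
  · rintro ⟨h1, h2⟩ i hi
    constructor
    · exact fun hb => h1 _ ⟨i, hi, hb, rfl⟩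
    · intro h
      by_contra hb
      exact h2 _ ⟨i, hi, Bool.eq_false_iff.2 hb, rfl⟩ h

theorem isConsistent_iff {σ : List Bool} :
    IsConsistent σ ↔ Satisfiable (declaredWords true σ) (declaredWords false σ) := by
  simp only [IsConsistent, Satisfiable, wordDiagram_eq_iff_declaredWords]

theorem primrec_declaredWords (b : Bool) : Primrec (declaredWords b) := by
  refine Primrec.list_flatMap (Primrec.list_range.comp Primrec.list_length) ?_
  exact Primrec.ite (Primrec.eq.comp (Primrec.list_getI.comp Primrec.fst Primrec.snd)
    (Primrec.const b)) (Primrec.list_cons.comp ((primrec_decodeD _).comp Primrec.snd)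
      (Primrec.const [])) (Primrec.const [])

theorem predIn_isConsistent : PredIn (oracleOf zeroJump) IsConsistent :=
  (predIn_satisfiable.comp ((primrec_declaredWords true).pair
    (primrec_declaredWords false)).computableIn).of_iff fun _ => isConsistent_iff.symm

end Diagrams

/-! ### Systems over the generators, and the density of settling them. -/

section Systems

theorem primrec_rename {α : Type*} [Primcodable α] {f : α → ℕ → ℕ} (hf : Primrec₂ f) :
    Primrec₂ fun a (w : GWord ℕ) => rename (f a) w :=
  Primrec.list_map Primrec.snd (Primrec.pair
    (hf.comp (Primrec.fst.comp Primrec.fst) (Primrec.fst.comp Primrec.snd))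
    (Primrec.snd.comp Primrec.snd))

/-- In a system of equations and inequations the letters `2 * i` are parameters and the letters
`2 * j + 1` are unknowns. This substitutes generator `i` for parameter `i`, and generator `n + j`
for unknown `j`. -/
def substLetter (n l : ℕ) : ℕ := if l % 2 = 0 then l / 2 else n + l / 2

@[simp]
theorem substLetter_even (n i : ℕ) : substLetter n (2 * i) = i := by
  simp [substLetter]

@[simp]
theorem substLetter_odd (n j : ℕ) : substLetter n (2 * j + 1) = n + j := by
  rw [substLetter, if_neg (by omega)]
  omega

theorem primrec_substLetter : Primrec₂ substLetter :=
  Primrec.ite (Primrec.eq.comp (Primrec.nat_mod.comp Primrec.snd (Primrec.const 2))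
    (Primrec.const 0)) (Primrec.nat_div.comp Primrec.snd (Primrec.const 2))
    (Primrec.nat_add.comp Primrec.fst (Primrec.nat_div.comp Primrec.snd (Primrec.const 2)))

/-- The string `σ` declares that the generators from number `n` on solve the system `(P, Q)`. -/
def DeclaresSolution (x : List (GWord ℕ) × List (GWord ℕ)) (σ : List Bool) (n : ℕ) : Prop :=
  (∀ p ∈ x.1, σ[encode (rename (substLetter n) p)]? = some true) ∧
    ∀ q ∈ x.2, σ[encode (rename (substLetter n) q)]? = some false

/-- The system `(P, Q)` has no solution in any marked group whose diagram begins with `σ`. -/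
def Refutes (x : List (GWord ℕ) × List (GWord ℕ)) (σ : List Bool) : Prop :=
  ¬ Satisfiable ((declaredWords true σ).map (rename fun i => 2 * i) ++ x.1)
    ((declaredWords false σ).map (rename fun i => 2 * i) ++ x.2)

/-- The string `σ` declares a solution of the system `(P, Q)`, or it refutes the system. -/
def Settles (x : List (GWord ℕ) × List (GWord ℕ)) (σ : List Bool) : Prop :=
  (∃ n < σ.length, DeclaresSolution x σ n) ∨ Refutes x σ

variable {x : List (GWord ℕ) × List (GWord ℕ)} {σ τ : List Bool}

theorem not_refutes_iff :
    ¬ Refutes x σ ↔ ∃ (G : Type) (_ : Group G) (z : ℕ → G),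
      wordDiagram (fun i => z (2 * i)) σ.length = σ ∧
        (∀ p ∈ x.1, wordEval z p = 1) ∧ ∀ q ∈ x.2, wordEval z q ≠ 1 := by
  rw [Refutes, not_not, Satisfiable]
  refine exists_congr fun G => exists_congr fun _ => exists_congr fun z => ?_
  rw [wordDiagram_eq_iff_declaredWords]
  simp only [List.forall_mem_append, List.forall_mem_map, wordEval_rename]
  tauto

theorem primrecPred_declaresSolution :
    PrimrecPred fun y : ((List (GWord ℕ) × List (GWord ℕ)) × List Bool) × ℕ =>
      DeclaresSolution y.1.1 y.1.2 y.2 := by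
  have h : ∀ b : Bool, PrimrecRel fun (w : GWord ℕ) (y : List Bool × ℕ) =>
      y.1[encode (rename (substLetter y.2) w)]? = some b := fun b =>
    Primrec.eq.comp (Primrec.list_getElem?.comp (Primrec.fst.comp Primrec.snd)
      (Primrec.encode.comp ((primrec_rename primrec_substLetter).comp
        (Primrec.snd.comp Primrec.snd) Primrec.fst))) (Primrec.const (some b))
  have hy : Primrec fun y : ((List (GWord ℕ) × List (GWord ℕ)) × List Bool) × ℕ =>
      (y.1.2, y.2) := Primrec.pair (Primrec.snd.comp Primrec.fst) Primrec.snd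
  have hx : Primrec fun y : ((List (GWord ℕ) × List (GWord ℕ)) × List Bool) × ℕ => y.1.1 :=
    Primrec.fst.comp Primrec.fst
  exact ((h true).forall_mem_list.comp (Primrec.fst.comp hx) hy).and
    ((h false).forall_mem_list.comp (Primrec.snd.comp hx) hy)

theorem predIn_settles : PredIn (oracleOf zeroJump)
    fun y : (List (GWord ℕ) × List (GWord ℕ)) × List Bool => Settles y.1 y.2 := by
  have h : ∀ b : Bool, Primrec fun y : (List (GWord ℕ) × List (GWord ℕ)) × List Bool =>
      (declaredWords b y.2).map (rename fun i => 2 * i) := fun b =>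
    Primrec.list_map ((primrec_declaredWords b).comp Primrec.snd)
      ((primrec_rename (f := fun (_ : Unit) i => 2 * i)
        (Primrec.nat_double.comp Primrec.snd)).comp (Primrec.const ()) Primrec.snd)
  have href : PredIn (oracleOf zeroJump)
      fun y : (List (GWord ℕ) × List (GWord ℕ)) × List Bool => Refutes y.1 y.2 :=
    (predIn_satisfiable.comp (Primrec.pair
      (Primrec.list_append.comp (h true) (Primrec.fst.comp Primrec.fst))
      (Primrec.list_append.comp (h false) (Primrec.snd.comp Primrec.fst))).computableIn).not
  exact (PredIn.exists_lt (PredIn.of_primrec primrecPred_declaresSolution)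
    (Primrec.list_length.comp Primrec.snd).computableIn).or href

theorem getElem?_of_prefix (h : σ <+: τ) {i : ℕ} {b : Bool} (hi : σ[i]? = some b) :
    τ[i]? = some b := by
  obtain ⟨l, rfl⟩ := h
  rw [List.getElem?_append_left (List.getElem?_eq_some_iff.1 hi).1, hi]

theorem Settles.of_prefix (h : σ <+: τ) (hσ : Settles x σ) : Settles x τ := by
  rcases hσ with ⟨n, hn, h1, h2⟩ | hσ
  · exact Or.inl ⟨n, hn.trans_le h.length_le, fun p hp => getElem?_of_prefix h (h1 p hp),
      fun q hq => getElem?_of_prefix h (h2 q hq)⟩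
  · right
    contrapose! hσ
    rw [not_refutes_iff] at hσ ⊢
    obtain ⟨G, _, z, hz, hx⟩ := hσ
    refine ⟨G, ‹Group G›, z, ?_, hx⟩
    have h1 : wordDiagram (fun i => z (2 * i)) σ.length <+: τ := by
      rw [← hz]
      exact wordDiagram_prefix h.length_le
    exact (List.prefix_of_prefix_length_le h1 h (by simp)).eq_of_length (by simp)

/-- If `σ` does not refute the system, some marked group with diagram extending `σ` has a solution.
Only finitely many generators occur in the system and in the words decided by `σ`, so the later
generators can be re-marked as the solution without disturbing `σ`. -/
theorem denseIn_settles : DenseIn IsConsistent (Settles x) := by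
  intro σ hσ
  by_cases href : Refutes x σ
  · exact ⟨σ, List.prefix_rfl, hσ, Or.inr href⟩
  obtain ⟨G, _, z, hz, h1, h2⟩ := not_refutes_iff.1 href
  obtain ⟨n, hn⟩ := exists_letters_lt
    (x.1 ++ x.2 ++ (List.range σ.length).map (decodeD (GWord ℕ)))
  -- Even letters of `z` are the old generators and odd ones the unknowns; from number `n` on, the
  -- new marking lists the unknowns, in accordance with `substLetter`.
  set y : ℕ → G := fun i => if i < n then z (2 * i) else z (2 * (i - n) + 1)
  have hy : ∀ w ∈ x.1 ++ x.2, wordEval y (rename (substLetter n) w) = wordEval z w := by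
    intro w hw
    rw [wordEval_rename]
    refine wordEval_congr fun l hl => ?_
    have hln := hn w (List.mem_append_left _ hw) l hl
    obtain ⟨i, hi | hi⟩ := Nat.even_or_odd' l.1
    · rw [hi, substLetter_even]
      exact if_pos (by omega)
    · rw [hi, substLetter_odd]
      simp [y]
  obtain ⟨t, ht⟩ := exists_forall_mem_lt
    ((x.1 ++ x.2).map fun w => encode (rename (substLetter n) w))
  have hσy : σ <+: wordDiagram y (σ.length + n + t + 1) := by
    have : wordDiagram y σ.length = σ := by
      rw [wordDiagram_eq_iff] at hz ⊢
      intro i hi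
      rw [hz i hi]
      rw [wordEval_congr (v := y) (v' := fun i => z (2 * i))]
      intro l hl
      exact if_pos (hn _ (List.mem_append_right _
        (List.mem_map_of_mem (List.mem_range.2 hi))) l hl)
    rw [← this, length_wordDiagram]
    exact wordDiagram_prefix (by omega)
  refine ⟨_, hσy, isConsistent_wordDiagram _ _, Or.inl ⟨n, by rw [length_wordDiagram]; omega,
    fun p hp => ?_, fun q hq => ?_⟩⟩
  · have hp' := List.mem_append_left x.2 hp
    have := ht _ (List.mem_map_of_mem hp')
    rw [wordDiagram_getElem?_encode, hy p hp', h1 p hp]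
    exact ⟨by omega, by simp⟩
  · have hq' := List.mem_append_right x.1 hq
    have := ht _ (List.mem_map_of_mem hq')
    rw [wordDiagram_getElem?_encode, hy q hq']
    exact ⟨by omega, by simp [h2 q hq]⟩

end Systems

/-! ### From paths to existentially closed groups. -/

section GroupOfPath

variable {X : ℕ → Bool}

/-- A path through the tree of consistent strings is the word diagram of a marked group. -/
theorem exists_group_of_path (hX : ∀ s, IsConsistent ((List.range s).map X)) :
    ∃ (M : Type) (_ : Group M) (v : ℕ → M), (∀ a, ∃ w, wordEval v w = a) ∧
      ∀ s, wordDiagram v s = (List.range s).map X := by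
  classical
  have happrox : ∀ s, ∃ (G : Type) (_ : Group G) (v : ℕ → G),
      ∀ i < s, (X i = true ↔ wordEval v (decodeD (GWord ℕ) i) = 1) := by
    intro s
    obtain ⟨G, _, v, hv⟩ := hX s
    rw [wordDiagram_eq_iff] at hv
    refine ⟨G, ‹Group G›, v, fun i hi => ?_⟩
    have := hv i (by simpa using hi)
    rwa [getI_map_range _ hi] at this
  -- Any finite set of words is judged by `X` as in an actual group. This is all that is needed to
  -- check that the trivial words form a normal subgroup.
  have hcode : ∀ l : List (GWord ℕ), ∃ (G : Type) (_ : Group G) (v : ℕ → G),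
      ∀ w ∈ l, (X (encode w) = true ↔ wordEval v w = 1) := by
    intro l
    obtain ⟨s, hs⟩ := exists_forall_mem_lt (l.map encode)
    obtain ⟨G, _, v, hv⟩ := happrox s
    refine ⟨G, ‹Group G›, v, fun w hw => ?_⟩
    rw [hv _ (hs _ (List.mem_map_of_mem hw)), decodeD_encode]
  have hmk : ∀ (x : FreeGroup ℕ) {G : Type} [Group G] (v : ℕ → G),
      wordEval v x.toWord = FreeGroup.lift v x := by
    intro x G _ v
    rw [wordEval, FreeGroup.mk_toWord]
  let N : Subgroup (FreeGroup ℕ) :=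
    { carrier := {x | X (encode x.toWord) = true}
      one_mem' := by
        obtain ⟨G, _, v, hv⟩ := hcode [(1 : FreeGroup ℕ).toWord]
        change X _ = true
        rw [hv _ (by simp), hmk, map_one]
      mul_mem' := by
        intro x y hx hy
        obtain ⟨G, _, v, hv⟩ := hcode [x.toWord, y.toWord, (x * y).toWord]
        change X _ = true at hx hy ⊢
        rw [hv _ (by simp), hmk] at hx hy ⊢
        rw [map_mul, hx, hy, one_mul]
      inv_mem' := by
        intro x hx
        obtain ⟨G, _, v, hv⟩ := hcode [x.toWord, x⁻¹.toWord]
        change X _ = true at hx ⊢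
        rw [hv _ (by simp), hmk] at hx ⊢
        rw [map_inv, hx, inv_one] }
  have hN : N.Normal := by
    constructor
    intro x hx g
    obtain ⟨G, _, v, hv⟩ := hcode [x.toWord, (g * x * g⁻¹).toWord]
    change X _ = true at hx ⊢
    rw [hv _ (by simp), hmk] at hx ⊢
    simp [hx]
  have hev : ∀ w : GWord ℕ, wordEval (fun i => (QuotientGroup.mk' N) (FreeGroup.of i)) w =
      (QuotientGroup.mk' N) (FreeGroup.mk w) := by
    intro w
    rw [← map_wordEval, wordEval_of]
  refine ⟨FreeGroup ℕ ⧸ N, inferInstance, fun i => (QuotientGroup.mk' N) (FreeGroup.of i), ?_, ?_⟩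
  · intro a
    obtain ⟨x, rfl⟩ := QuotientGroup.mk'_surjective N a
    exact ⟨x.toWord, by rw [hev, FreeGroup.mk_toWord]⟩
  · intro s
    have key := wordDiagram_eq_iff (v := fun i => (QuotientGroup.mk' N) (FreeGroup.of i))
      (σ := (List.range s).map X)
    rw [List.length_map, List.length_range] at key
    refine key.2 fun i hi => ?_
    rw [getI_map_range _ hi, hev, QuotientGroup.mk'_apply, QuotientGroup.eq_one_iff]
    set w := decodeD (GWord ℕ) i with hw
    change _ ↔ X (encode (FreeGroup.mk w).toWord) = true
    -- The subgroup is defined through reduced words; a group that agrees with `X` on both `w` and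
    -- its reduced form carries this over to `w` itself.
    obtain ⟨G, _, v, hv⟩ := happrox (i + encode (FreeGroup.mk w).toWord + 1)
    rw [hv i (by omega), hv (encode (FreeGroup.mk w).toWord) (by omega), decodeD_encode, hmk]
    rfl

variable {M : Type} [Group M] {v : ℕ → M}

/-- An initial segment of the diagram of `M` cannot refute a system solved in an extension `H`,
since `H` with the images of the generators has the same diagram. So the system was settled by
declaring a solution. -/
theorem exists_solution (hset : ∀ x, ∃ s, Settles x (wordDiagram v s)) {H : Type} [Group H]
    {f : M →* H} (hf : Function.Injective f) {z : ℕ → H} (hz : ∀ i, z (2 * i) = f (v i))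
    {P Q : List (GWord ℕ)} (hP : ∀ p ∈ P, wordEval z p = 1) (hQ : ∀ q ∈ Q, wordEval z q ≠ 1) :
    ∃ n, (∀ p ∈ P, wordEval (fun l => v (substLetter n l)) p = 1) ∧
      ∀ q ∈ Q, wordEval (fun l => v (substLetter n l)) q ≠ 1 := by
  obtain ⟨s, ⟨n, -, h1, h2⟩ | href⟩ := hset (P, Q)
  · refine ⟨n, fun p hp => ?_, fun q hq => ?_⟩
    · have := h1 p hp
      rw [wordDiagram_getElem?_encode, wordEval_rename] at this
      simpa using this.2
    · have := h2 q hq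
      rw [wordDiagram_getElem?_encode, wordEval_rename] at this
      simpa using this.2
  · refine absurd href ?_
    rw [not_refutes_iff]
    refine ⟨H, inferInstance, z, ?_, hP, hQ⟩
    have hz' : (fun i => z (2 * i)) = fun i => f (v i) := funext hz
    rw [length_wordDiagram, hz']
    refine wordDiagram_congr fun w => ?_
    rw [← map_wordEval]
    exact map_eq_one_iff f hf

/-- Declared solutions consist of generators, so settling the equation that equates the unknown with
a word `w` makes the value of `w` a generator. -/
theorem surjective_of_settles (hset : ∀ x, ∃ s, Settles x (wordDiagram v s))
    (hgen : ∀ a, ∃ w, wordEval v w = a) : Function.Surjective v := by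
  intro a
  obtain ⟨w, rfl⟩ := hgen a
  set z : ℕ → M := fun l => if l % 2 = 0 then v (l / 2) else wordEval v w
  have hz : ∀ i, z (2 * i) = MonoidHom.id M (v i) := fun i => by simp [z]
  obtain ⟨n, hn, -⟩ := exists_solution hset Function.injective_id hz
    (P := [ rename (fun i => 2 * i) w ++ [(1, false)] ]) (Q := []) (by
      simp only [List.forall_mem_singleton, wordEval_append, wordEval_rename, hz]
      simp [z]) (by simp)
  refine ⟨n, ?_⟩
  simp only [List.forall_mem_singleton, wordEval_append, wordEval_rename,
    substLetter_even] at hn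
  have h1 : substLetter n 1 = n := substLetter_odd n 0
  simp only [wordEval_singleton, h1, cond_false, mul_inv_eq_one] at hn
  exact hn.symm

/-- Sort the atomic words of `θ` by whether they are trivial at the given solution in `H`. A
solution in `M` of the resulting system agrees on every atom, hence on `θ`. Each parameter is a
single generator by surjectivity of `v`. -/
theorem isExistentiallyClosed_of_settles (hset : ∀ x, ∃ s, Settles x (wordDiagram v s))
    (hgen : ∀ a, ∃ w, wordEval v w = a) : IsExistentiallyClosed M := by
  classical
  rintro k m θ hθ a ⟨H, _, f, hf, hr⟩
  rw [Language.BoundedFormula.realize_exs] at hr ⊢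
  obtain ⟨b, hb⟩ := hr
  choose c hc using surjective_of_settles hset hgen
  set letter : Fin k ⊕ Fin m → ℕ := Sum.elim (fun i => 2 * c (a i)) (fun j => 2 * j + 1)
  set z : ℕ → H := fun l => if l % 2 = 0 then f (v (l / 2))
    else if h : l / 2 < m then b ⟨l / 2, h⟩ else 1
  have hz : ∀ i, z (2 * i) = f (v i) := fun i => by simp [z]
  have hzl : (fun l => z (letter l)) = Sum.elim (fun i => f (a i)) b := by
    funext l
    rcases l with i | j
    · simp [letter, hz, hc]
    · have h1 : ¬ (2 * (j : ℕ) + 1) % 2 = 0 := by omega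
      have h2 : (2 * (j : ℕ) + 1) / 2 = j := by omega
      simp [letter, z, h2]
  obtain ⟨n, h1, h2⟩ := exists_solution hset hf hz
    (P := ((atomWords θ).filter fun w => wordEval z (rename letter w) = 1).map (rename letter))
    (Q := ((atomWords θ).filter fun w => wordEval z (rename letter w) ≠ 1).map (rename letter))
    (fun p hp => by
      obtain ⟨w, hw, rfl⟩ := List.mem_map.1 hp
      simpa using (List.mem_filter.1 hw).2)
    (fun p hp => by
      obtain ⟨w, hw, rfl⟩ := List.mem_map.1 hp
      simpa using (List.mem_filter.1 hw).2)
  refine ⟨fun j => v (n + j), (realize_iff_of_atomWords hθ fun w hw => ?_).1 hb⟩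
  have hvl : (fun l => v (substLetter n (letter l))) =
      Sum.elim a fun j : Fin m => v (n + j) := by
    funext l
    rcases l with i | j
    · simp [letter, hc]
    · simp [letter]
  rw [← hzl, ← hvl, ← wordEval_rename,
    ← wordEval_rename letter (fun l => v (substLetter n l))]
  constructor
  · intro h
    exact h1 _ (List.mem_map_of_mem (List.mem_filter.2 ⟨hw, by simpa using h⟩))
  · intro h
    by_contra hne
    exact h2 _ (List.mem_map_of_mem (List.mem_filter.2 ⟨hw, by simpa using hne⟩)) h

end GroupOfPath

/-! ### Distinguishing tuples, and isolation when this is not dense. -/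

section Isolation

variable {N : Type*} [Group N]

/-- The string `σ` declares that some relation between the generators `(l j).1` holds or fails,
contrary to what is true of the elements `d (l j).2` of `N`. -/
def Distinguishes (d : ℕ → N) (l : List (ℕ × ℕ)) (σ : List Bool) : Prop :=
  ∃ i < σ.length, (∀ x ∈ decodeD (GWord ℕ) i, x.1 < l.length) ∧
    ((σ[encode (rename (fun j => (l.getI j).1) (decodeD (GWord ℕ) i))]? = some true ∧
        ¬ wordEval d (rename (fun j => (l.getI j).2) (decodeD (GWord ℕ) i)) = 1) ∨
      (σ[encode (rename (fun j => (l.getI j).1) (decodeD (GWord ℕ) i))]? = some false ∧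
        wordEval d (rename (fun j => (l.getI j).2) (decodeD (GWord ℕ) i)) = 1))

theorem Distinguishes.of_prefix {d : ℕ → N} {l : List (ℕ × ℕ)} {σ τ : List Bool} (h : σ <+: τ)
    (hσ : Distinguishes d l σ) : Distinguishes d l τ := by
  obtain ⟨i, hi, hl, hσ⟩ := hσ
  exact ⟨i, hi.trans_le h.length_le, hl,
    hσ.imp (And.imp_left (getElem?_of_prefix h)) (And.imp_left (getElem?_of_prefix h))⟩

theorem predIn_distinguishes {O : Set (ℕ →. ℕ)} {d : ℕ → N}
    (hd : PredIn O fun w : GWord ℕ => wordEval d w = 1) :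
    PredIn O fun y : List (ℕ × ℕ) × List Bool => Distinguishes d y.1 y.2 := by
  have hu : Primrec fun y : (List (ℕ × ℕ) × List Bool) × ℕ => decodeD (GWord ℕ) y.2 :=
    (primrec_decodeD _).comp Primrec.snd
  have hl : Primrec fun y : (List (ℕ × ℕ) × List Bool) × ℕ => y.1.1 :=
    Primrec.fst.comp Primrec.fst
  have hget : Primrec₂ fun (l : List (ℕ × ℕ)) j => l.getI j := Primrec.list_getI
  have h1 := (primrec_rename (f := fun (l : List (ℕ × ℕ)) j => (l.getI j).1)
    (Primrec.fst.comp hget)).comp hl hu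
  have h2 := (primrec_rename (f := fun (l : List (ℕ × ℕ)) j => (l.getI j).2)
    (Primrec.snd.comp hget)).comp hl hu
  have hlt : PrimrecRel fun (x : ℕ × Bool) (l : List (ℕ × ℕ)) => x.1 < l.length :=
    Primrec.nat_lt.comp (Primrec.fst.comp Primrec.fst) (Primrec.list_length.comp Primrec.snd)
  have hbit : ∀ b : Bool, PrimrecPred fun y : (List (ℕ × ℕ) × List Bool) × ℕ =>
      y.1.2[encode (rename (fun j => (y.1.1.getI j).1) (decodeD (GWord ℕ) y.2))]? = some b :=
    fun b => Primrec.eq.comp (Primrec.list_getElem?.comp (Primrec.snd.comp Primrec.fst)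
      (Primrec.encode.comp h1)) (Primrec.const (some b))
  have hdN := hd.comp h2.computableIn
  exact PredIn.exists_lt ((PredIn.of_primrec (hlt.forall_mem_list.comp hu hl)).and
    (((PredIn.of_primrec (hbit true)).and hdN.not).or
      ((PredIn.of_primrec (hbit false)).and hdN)))
    (Primrec.list_length.comp Primrec.snd).computableIn

/-- The pairs of indices of two tuples, as a list. -/
def indexPairs {k : ℕ} (n m : Fin k → ℕ) : List (ℕ × ℕ) := List.ofFn fun j => (n j, m j)

theorem not_distinguishes_iff {k : ℕ} {n m : Fin k → ℕ} {G : Type*} [Group G] {v : ℕ → G}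
    {d : ℕ → N} :
    (∀ s, ¬ Distinguishes d (indexPairs n m) (wordDiagram v s)) ↔
      ∀ u : GWord (Fin k), wordEval (fun j => v (n j)) u = 1 ↔
        wordEval (fun j => d (m j)) u = 1 := by
  have hget : ∀ j : Fin k, (indexPairs n m).getI j = (n j, m j) := by
    intro j
    rw [List.getI_eq_getElem _ (by simp [indexPairs])]
    simp [indexPairs]
  constructor
  · intro h u
    set u' : GWord ℕ := rename (fun j : Fin k => (j : ℕ)) u with hu'
    have h1 : rename (fun j => ((indexPairs n m).getI j).1) u' = rename n u := by
      rw [hu', rename_rename]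
      simp only [hget]
    have h2 : rename (fun j => ((indexPairs n m).getI j).2) u' = rename m u := by
      rw [hu', rename_rename]
      simp only [hget]
    by_contra hne
    -- Long enough for the index of `u'` to lie below the length and for the word in the generators
    -- to be decided.
    apply h (encode u' + encode (rename n u) + 1)
    refine ⟨encode u', by rw [length_wordDiagram]; omega, ?_, ?_⟩
    · intro x hx
      rw [decodeD_encode, hu', rename] at hx
      obtain ⟨y, -, rfl⟩ := List.mem_map.1 hx
      simp [indexPairs]
    · rw [decodeD_encode, h1, h2, wordDiagram_getElem?_encode, wordDiagram_getElem?_encode,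
        wordEval_rename, wordEval_rename]
      have hlt : encode (rename n u) < encode u' + encode (rename n u) + 1 := by omega
      simp only [hlt, true_and]
      by_cases h3 : wordEval (fun j => v (n j)) u = 1 <;>
        by_cases h4 : wordEval (fun j => d (m j)) u = 1 <;> simp_all
  · rintro h s ⟨i, hi, hl, hσ⟩
    obtain ⟨u, hu⟩ : ∃ u : GWord (Fin k), rename (fun j : Fin k => (j : ℕ)) u =
        decodeD (GWord ℕ) i := by
      generalize decodeD (GWord ℕ) i = w at hl
      induction w with
      | nil => exact ⟨[], rfl⟩
      | cons x w ih =>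
        obtain ⟨u, hu⟩ := ih fun y hy => hl y (List.mem_cons_of_mem _ hy)
        have hx : x.1 < k := by simpa [indexPairs] using hl x List.mem_cons_self
        exact ⟨(⟨x.1, hx⟩, x.2) :: u, by rw [← hu]; rfl⟩
    rw [← hu, rename_rename, rename_rename, wordDiagram_getElem?_encode,
      wordDiagram_getElem?_encode, wordEval_rename, wordEval_rename] at hσ
    simp only [hget, h u] at hσ
    rcases hσ with ⟨⟨-, h1⟩, h2⟩ | ⟨⟨-, h1⟩, h2⟩
    · exact h2 (h1.1 trivial)
    · exact absurd (h1.2 h2) (by simp)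

/-- A complete quantifier-free type contains each quantifier-free formula or its negation, so
inclusion already forces equality. -/
theorem qfType_eq_of_forall_mem {k : ℕ} {G G' : Type*} [Group G] [Group G'] {a : Fin k → G}
    {b : Fin k → G'} (h : ∀ ψ ∈ qfType b, ψ.Realize a) : qfType b = qfType a := by
  ext ψ
  refine ⟨fun hψ => ⟨hψ.1, h ψ hψ⟩, fun hψ => ⟨hψ.1, ?_⟩⟩
  by_contra hb
  have := h (∼ψ) ⟨hψ.1.not, by rwa [Language.Formula.realize_not]⟩
  rw [Language.Formula.realize_not] at this
  exact this hψ.2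

section DiagramFormula

variable {G : Type*} [Group G]

/-- The quantifier-free formula `θ(ȳ, x̄)` which says that `x̄` has a word diagram beginning with
`σ`, and that `y j` is `x (n j)` for all `j`. -/
noncomputable def diagramFormula {k : ℕ} (n : Fin k → ℕ) (σ : List Bool) (r : ℕ) :
    LGroup.BoundedFormula (Fin k) (r + 1) :=
  ((List.finRange k).map (fun j => (Language.Term.var (Sum.inl j) : LGroup.Term _) ='
      Language.Term.var (Sum.inr (Fin.ofNat (r + 1) (n j)))) ++
    (declaredWords true σ).map (fun w =>
      wordTerm (rename (fun i => Sum.inr (Fin.ofNat (r + 1) i)) w) =' wordTerm []) ++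
    (declaredWords false σ).map (fun w =>
      ∼(wordTerm (rename (fun i => Sum.inr (Fin.ofNat (r + 1) i)) w) =' wordTerm []))).foldr
    (· ⊓ ·) ⊤

theorem isQF_foldr_inf {α : Type*} {r : ℕ} {l : List (LGroup.BoundedFormula α r)}
    (h : ∀ φ ∈ l, φ.IsQF) : (l.foldr (· ⊓ ·) ⊤).IsQF := by
  induction l with
  | nil => exact Language.BoundedFormula.IsQF.top
  | cons φ l ih =>
    exact (h φ List.mem_cons_self).inf (ih fun ψ hψ => h ψ (List.mem_cons_of_mem _ hψ))

theorem isQF_diagramFormula {k : ℕ} (n : Fin k → ℕ) (σ : List Bool) (r : ℕ) :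
    (diagramFormula n σ r).IsQF := by
  apply isQF_foldr_inf
  have heq : ∀ s t : LGroup.Term (Fin k ⊕ Fin (r + 1)), (s =' t).IsQF := fun s t =>
    (Language.BoundedFormula.IsAtomic.equal s t).isQF
  simp only [List.forall_mem_append, List.forall_mem_map]
  exact ⟨⟨fun _ _ => heq _ _, fun _ _ => heq _ _⟩, fun _ _ => (heq _ _).not⟩

theorem realize_diagramFormula {k : ℕ} {n : Fin k → ℕ} {σ : List Bool} {r : ℕ} {a : Fin k → G}
    {xs : Fin (r + 1) → G} :
    (diagramFormula n σ r).Realize a xs ↔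
      (∀ j, a j = xs (Fin.ofNat (r + 1) (n j))) ∧
        wordDiagram (fun i => xs (Fin.ofNat (r + 1) i)) σ.length = σ := by
  rw [diagramFormula, Language.BoundedFormula.realize_foldr_inf, wordDiagram_eq_iff_declaredWords]
  simp only [List.forall_mem_append, List.forall_mem_map, Language.BoundedFormula.realize_bdEqual,
    Language.BoundedFormula.realize_not, realize_wordTerm, wordEval_rename, wordEval_nil,
    Language.Term.realize_var, Sum.elim_inl, Sum.elim_inr, List.mem_finRange, true_implies,
    and_assoc]

end DiagramFormula

/-- Failure of density gives a consistent `σ` none of whose consistent extensions distinguishes the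
tuples. In every marked group with diagram beginning with `σ`, the chosen generators then have the
type of the tuple in `N`. Saying that `y` is the corresponding part of a tuple with diagram
beginning with `σ` is existential, and it isolates this type. -/
theorem isExistsIsolated_of_not_denseIn {k : ℕ} {n m : Fin k → ℕ} {d : ℕ → N}
    (h : ¬ DenseIn IsConsistent (Distinguishes d (indexPairs n m))) :
    IsExistsIsolated (qfType fun j => d (m j)) := by
  rw [DenseIn] at h
  push Not at h
  obtain ⟨σ, hσ, hext⟩ := h
  have key : ∀ {G : Type} [Group G] (y : ℕ → G), wordDiagram y σ.length = σ →
      qfType (fun j => y (n j)) = qfType fun j => d (m j) := by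
    intro G _ y hy
    apply qfType_eq_of_wordEval
    rw [← not_distinguishes_iff]
    intro s hs
    have hpre : σ <+: wordDiagram y (max σ.length s) := by
      conv_lhs => rw [← hy]
      exact wordDiagram_prefix (le_max_left _ _)
    exact hext _ hpre (isConsistent_wordDiagram _ _)
      (hs.of_prefix (wordDiagram_prefix (le_max_right _ _)))
  -- All generators that matter have number below `r`, so reduction modulo `r + 1` in
  -- `diagramFormula` leaves them unchanged.
  obtain ⟨r, hr⟩ := exists_letters_lt (List.ofFn (fun j => [(n j, true)]) ++
    (List.range σ.length).map (decodeD (GWord ℕ)))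
  have hrn : ∀ j, n j < r := fun j =>
    hr [(n j, true)] (List.mem_append_left _ (List.mem_ofFn.2 ⟨j, rfl⟩)) (n j, true) (by simp)
  have hmod : ∀ {i}, i < r → ((Fin.ofNat (r + 1) i : Fin (r + 1)) : ℕ) = i := fun hi =>
    Nat.mod_eq_of_lt (by omega)
  obtain ⟨G, _, y, hy⟩ := hσ
  have hreal : (diagramFormula n σ r).exs.Realize fun j => y (n j) := by
    rw [Language.BoundedFormula.realize_exs]
    refine ⟨fun i => y i, realize_diagramFormula.2 ⟨fun j => by rw [hmod (hrn j)], ?_⟩⟩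
    rw [wordDiagram_eq_iff] at hy ⊢
    intro i hi
    rw [hy i hi]
    rw [wordEval_congr (v := y) (v' := fun i => y (Fin.ofNat (r + 1) i))]
    intro x hx
    rw [hmod (hr _ (List.mem_append_right _ (List.mem_map_of_mem (List.mem_range.2 hi))) x hx)]
  refine ⟨r + 1, diagramFormula n σ r, isQF_diagramFormula n σ r,
    ⟨⟨G, _, _, key y hy⟩, G, _, _, hreal, ?_⟩, ?_⟩
  · intro ψ hψ
    rw [← key y hy] at hψ
    exact hψ.2
  · rintro _ ⟨G₁, _, b, rfl⟩ ⟨G₂, _, a, ha, hb⟩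
    rw [qfType_eq_of_forall_mem hb]
    rw [Language.BoundedFormula.realize_exs] at ha
    obtain ⟨xs, hxs⟩ := ha
    obtain ⟨h1, h2⟩ := realize_diagramFormula.1 hxs
    rw [← key _ h2, ← funext h1]

/-- The formula which says that the word `u` is trivial. -/
def wordFormula {k : ℕ} (u : GWord (Fin k)) : LGroup.Formula (Fin k) :=
  wordTerm (rename Sum.inl u) =' wordTerm []

theorem wordFormula_mem_qfType {k : ℕ} {G : Type*} [Group G] {a : Fin k → G}
    {u : GWord (Fin k)} : wordFormula u ∈ qfType a ↔ wordEval a u = 1 := by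
  have h : (wordFormula u).Realize a ↔ wordEval a u = 1 := by
    rw [wordFormula, Language.Formula.Realize, Language.BoundedFormula.realize_bdEqual,
      realize_wordTerm, realize_wordTerm, wordEval_rename, wordEval_nil]
    simp only [Sum.elim_inl]
  exact (and_iff_right (Language.BoundedFormula.IsAtomic.equal _ _).isQF).trans h

/-- If a type realised in both groups is not isolated, then distinguishing the two realisations is
dense, so it happens along the diagram of `M`, and the realisations do not have the same type after
all. -/
theorem relativelyAtomic_of_distinguishes {M : Type*} [Group M] {v : ℕ → M}
    (hv : Function.Surjective v) {d : ℕ → N} (hd : Function.Surjective d)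
    (h : ∀ l, DenseIn IsConsistent (Distinguishes d l) →
      ∃ s, Distinguishes d l (wordDiagram v s)) : RelativelyAtomic M N := by
  rintro k Φ ⟨a, ha⟩ ⟨b, rfl⟩
  choose n hn using fun j => hv (a j)
  choose m hm using fun j => hd (b j)
  obtain rfl : (fun j => v (n j)) = a := funext hn
  obtain rfl : (fun j => d (m j)) = b := funext hm
  by_contra hiso
  obtain ⟨s, hs⟩ := h (indexPairs n m) (by
    by_contra hdense
    exact hiso (isExistsIsolated_of_not_denseIn hdense))
  refine not_distinguishes_iff.2 (fun u => ?_) s hs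
  rw [← wordFormula_mem_qfType, ← wordFormula_mem_qfType, ha]

end Isolation

/-! ### Assembly of the groups. -/

section Construction

/-- A path through the consistent strings that settles all systems yields an existentially closed
group. -/
theorem exists_isExistentiallyClosed {A : Set ℕ} {X : ℕ → Bool}
    (hX : ComputableIn (oracleOf A) X) (hcons : ∀ s, IsConsistent ((List.range s).map X))
    (hset : ∀ x, ∃ s, Settles x ((List.range s).map X)) :
    ∃ (M : Type) (_ : Group M), IsExistentiallyClosed M ∧ IsComputableFrom A M ∧
      ∃ v : ℕ → M, Function.Surjective v ∧ ∀ s, wordDiagram v s = (List.range s).map X := by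
  obtain ⟨M, _, v, hgen, hv⟩ := exists_group_of_path hcons
  have hset' : ∀ x, ∃ s, Settles x (wordDiagram v s) := by simpa only [hv] using hset
  have hsurj := surjective_of_settles hset' hgen
  refine ⟨M, _, isExistentiallyClosed_of_settles hset' hgen, ⟨v, hsurj, ?_⟩, v, hsurj, hv⟩
  rw [turingLE_iff_predIn]
  refine predIn_qfDiagram (((PredIn.of_eq_true hX).comp Primrec.encode.computableIn).of_iff
    fun w => ?_)
  have hbit := wordDiagram_getElem?_encode (v := v) (s := encode w + 1) (w := w)
    (b := X (encode w))
  rw [hv] at hbit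
  exact (hbit.1 (by simp)).2

/-- Here every requirement is dense, so `0′` finds search bounds uniformly and no escaping function
is needed: summing the bounds over requirements and lengths up to `s` gives a monotone `g` that
eventually suffices for each requirement. -/
theorem exists_computable_isExistentiallyClosed :
    ∃ (N : Type) (_ : Group N), IsExistentiallyClosed N ∧ IsComputableFrom zeroJump N := by
  set U : ℕ → List Bool → Prop :=
    fun e σ => Settles (decodeD (List (GWord ℕ) × List (GWord ℕ)) e) σ
  have hU : PredIn (oracleOf zeroJump) fun x : ℕ × List Bool => U x.1 x.2 :=
    predIn_settles.comp (((primrec_decodeD _).comp Primrec.fst).pair Primrec.snd).computableIn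
  obtain ⟨f, hf, hfb⟩ := exists_reachBound predIn_isConsistent hU fun _ => denseIn_settles
  set g : ℕ → ℕ := fun s => ∑ i ∈ Finset.range (s + 1), ∑ e ∈ Finset.range (s + 1), f e i
  have hg : ComputableIn (oracleOf zeroJump) g := by
    refine ComputableIn.sum_range
      (h := fun s i => ∑ e ∈ Finset.range (s + 1), f e i) ?_ ComputableIn.succ
    exact ComputableIn.sum_range (α := ℕ × ℕ) (h := fun x e => f e x.2) (f := fun x => x.1 + 1)
      (hf.comp (ComputableIn.snd.pair (ComputableIn.snd.comp ComputableIn.fst)))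
      (ComputableIn.succ.comp ComputableIn.fst)
  have hgm : Monotone g := by
    intro s t hst
    exact (Finset.sum_le_sum_of_subset (Finset.range_mono (by omega))).trans
      (Finset.sum_le_sum fun i _ => Finset.sum_le_sum_of_subset (Finset.range_mono (by omega)))
  have hreach : ∀ e, DenseIn IsConsistent (U e) → ∀ s₀, ∃ s ≥ s₀,
      ReachBound IsConsistent (U e) s (g s) := by
    intro e _ s₀
    refine ⟨max e s₀, le_max_right _ _, (hfb e (max e s₀)).mono ?_⟩
    refine (Finset.single_le_sum (f := fun e' => f e' (max e s₀)) (fun _ _ => Nat.zero_le _)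
      (Finset.mem_range.2 (Nat.lt_succ_of_le (le_max_left e s₀)))).trans ?_
    exact Finset.single_le_sum (s := Finset.range (max e s₀ + 1))
      (f := fun i => ∑ e' ∈ Finset.range (max e s₀ + 1), f e' i) (fun _ _ => Nat.zero_le _)
      (Finset.mem_range.2 (Nat.lt_succ_self _))
  obtain ⟨X, hX, hcons, hmeet⟩ := exists_path predIn_isConsistent hU hg hgm isConsistent_nil
    (fun _ h => h.exists_concat) (fun _ _ h h' => h'.of_prefix h)
    (fun _ _ _ h h' => h'.of_prefix h) hreach
  obtain ⟨N, _, h1, h2, -⟩ := exists_isExistentiallyClosed hX hcons fun x => by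
    obtain ⟨s, hs⟩ := hmeet (encode x) denseIn_settles
    exact ⟨s, by simpa [U] using hs⟩
  exact ⟨N, _, h1, h2⟩

theorem exists_relativelyAtomic {A : Set ℕ} (hce : CEIn zeroJump A) (hle : TuringLE zeroJump A)
    (hlt : ¬ TuringLE A zeroJump) {N : Type*} [Group N] (hN : IsComputableFrom zeroJump N) :
    ∃ (M : Type) (_ : Group M), IsExistentiallyClosed M ∧ IsComputableFrom A M ∧
      RelativelyAtomic M N := by
  obtain ⟨d, hd, hdiag⟩ := hN
  have hdN := predIn_wordEval (turingLE_iff_predIn.1 hdiag)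
  obtain ⟨g, hgm, hg, hesc⟩ := exists_escaping hce hle hlt
  -- The first component of the code `e` tells the two kinds of requirement apart: `0` for settling
  -- a system, anything else for distinguishing tuples.
  set U : ℕ → List Bool → Prop := fun e σ =>
    (e.unpair.1 = 0 ∧ Settles (decodeD (List (GWord ℕ) × List (GWord ℕ)) e.unpair.2) σ) ∨
      (¬ e.unpair.1 = 0 ∧ Distinguishes d (decodeD (List (ℕ × ℕ)) e.unpair.2) σ)
  have hU : PredIn (oracleOf zeroJump) fun x : ℕ × List Bool => U x.1 x.2 := by
    have h1 : Primrec fun x : ℕ × List Bool => x.1.unpair.1 :=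
      Primrec.fst.comp (Primrec.unpair.comp Primrec.fst)
    have h2 : Primrec fun x : ℕ × List Bool => x.1.unpair.2 :=
      Primrec.snd.comp (Primrec.unpair.comp Primrec.fst)
    have h0 := PredIn.of_primrec (O := oracleOf zeroJump)
      (Primrec.eq.comp h1 (Primrec.const 0))
    exact (h0.and (predIn_settles.comp
      (((primrec_decodeD _).comp h2).pair Primrec.snd).computableIn)).or
      (h0.not.and ((predIn_distinguishes hdN).comp
        (((primrec_decodeD _).comp h2).pair Primrec.snd).computableIn))
  have hU0 : ∀ x, U (Nat.pair 0 (encode x)) = Settles x := fun x => by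
    funext σ
    simp [U]
  have hU1 : ∀ l, U (Nat.pair 1 (encode l)) = Distinguishes d l := fun l => by
    funext σ
    simp [U]
  obtain ⟨X, hX, hcons, hmeet⟩ := exists_path (U := U) (g := g)
    (predIn_of_turingLE hle predIn_isConsistent) (predIn_of_turingLE hle hU) hg hgm
    isConsistent_nil (fun _ h => h.exists_concat) (fun _ _ h h' => h'.of_prefix h)
    (fun _ _ _ h h' => h'.imp (And.imp_right (Settles.of_prefix h))
      (And.imp_right (Distinguishes.of_prefix h)))
    -- For a fixed dense requirement the bound is computable from `0′`, though not uniformly in `e`;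
    -- this is enough, since `g` escapes each such function separately.
    (fun e he s₀ => by
      obtain ⟨f, hf, hfb⟩ := exists_reachBound (U := fun _ => U e) predIn_isConsistent
        (hU.comp ((ComputableIn.const e).pair ComputableIn.snd)) fun _ => he
      obtain ⟨s, hs, hfs⟩ := hesc (fun s => f 0 s)
        (hf.comp ((ComputableIn.const 0).pair ComputableIn.id)) s₀
      exact ⟨s, hs, (hfb 0 s).mono hfs⟩)
  obtain ⟨M, _, h1, h2, v, hv, hdiag⟩ := exists_isExistentiallyClosed hX hcons fun x => by
    rw [← hU0]
    exact hmeet _ (by rw [hU0]; exact denseIn_settles)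
  refine ⟨M, _, h1, h2, relativelyAtomic_of_distinguishes hv hd fun l hl => ?_⟩
  simp only [hdiag]
  rw [← hU1] at hl ⊢
  exact hmeet _ hl

end Construction

end ECGroups

theorem mainTheorem5 (A : Set ℕ)
    (hce : ECGroups.CEIn ECGroups.zeroJump A)
    (hle : ECGroups.TuringLE ECGroups.zeroJump A)
    (hlt : ¬ ECGroups.TuringLE A ECGroups.zeroJump) :
    (∀ (N : Type*) [Group N], ECGroups.IsExistentiallyClosed N →
      ECGroups.IsComputableFrom ECGroups.zeroJump N →
      ∃ (M : Type) (_ : Group M), ECGroups.IsExistentiallyClosed M ∧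
        ECGroups.IsComputableFrom A M ∧ ECGroups.RelativelyAtomic M N) ∧
    (∃ (M N : Type) (_ : Group M) (_ : Group N),
      (ECGroups.IsExistentiallyClosed M ∧ ECGroups.IsComputableFrom A M) ∧
      (ECGroups.IsExistentiallyClosed N ∧ ECGroups.IsComputableFrom A N) ∧
      ECGroups.RelativelyAtomic M N) := by
  refine ⟨fun N _ _ hN => ECGroups.exists_relativelyAtomic hce hle hlt hN, ?_⟩
  obtain ⟨N, _, hN, hN'⟩ := ECGroups.exists_computable_isExistentiallyClosed
  obtain ⟨M, _, hM, hM', hMN⟩ := ECGroups.exists_relativelyAtomic hce hle hlt hN'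
  obtain ⟨d, hd, hdiag⟩ := hN'
  exact ⟨M, N, _, _, ⟨hM, hM'⟩, ⟨hN, d, hd, TuringReducible.trans hdiag hle⟩, hMN⟩
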